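/- Let $a\ge 2$ be an integer and let $f(n)=\gamma_d n^d+\dots+\gamma_0$ be a polynomial with integer coefficients of degree $d\ge 1$ such that $\gamma_d>0$, $\gcd(\gamma_d,\dots,\gamma_0)=1$, and $f(n)$ is a positive integer for every positive integer $n$. Let $K_1,K_2,K_3,K_4>0$. Then there exist positive constants $x_0,c_1,c_2$, depending only on $a$, $f$ and $K_1,\dots,K_4$, such that the following holds. Let $\mathcal A=\{a_n\}_{n\ge 1}$ be a strictly increasing sequence of positive integers, and put $\mathcal A(x)=\#\{n: a_n\le x\}$ and, for a positive integer $r$, $\mathcal A(x,r)=\#\{n: a_n\le x \text{ and } a_n+r\in\mathcal A\}$. Let $\eta$ be a real-valued function and $X$ a real number such that for all real $x\ge X$ one has $\eta(x)>0$, \[ \mathcal A(x)\le K_1\frac{x}{\eta(x)},\qquad \frac{x}{\eta(x)}\le K_2\,\mathcal A(x),\qquad \mathcal A(x)\le K_3\,\mathcal A(x/2), \] and \[ \mathcal A(x,r)\le K_4\,\frac{r}{\varphi(r)}\,\frac{x}{\eta(x)^2}\qquad\text{for every positive integer } r, \] where $\varphi$ is Euler's totient function. For a positive integer $n$ let $r(n)$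 be the number of pairs $(k,p)$, with $k$ a positive integer and $p$ a prime, such that $a_k+a^{f(p)}=n$. Then \[ \#\Big\{1\le n\le x:\ r(n)\ge c_1\frac{(\log x)^{1/d}}{\eta(x)\log\log x}\Big\}\ \ge\ c_2\,x\,\frac{(\log x)^{1/d}}{(\log x)^{1/d}+\eta(x)\log\log x} \] for every real $x\ge \max(x_0,X)$. -/

import Mathlib

/-- The counting function `C(x)`: the number of indices `n` with `C n ≤ x`. Sequences are indexed
by `0, 1, 2, …`, so that `C n` is the `(n + 1)`-st term. -/
noncomputable def countUpTo (C : ℕ → ℕ) (x : ℝ) : ℕ :=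
  {n : ℕ | (C n : ℝ) ≤ x}.ncard

/-- `C(x, r)`: the number of indices `n` such that `C n ≤ x` and `C n + r` is a term of `C`. -/
noncomputable def countShift (C : ℕ → ℕ) (x : ℝ) (r : ℕ) : ℕ :=
  {n : ℕ | (C n : ℝ) ≤ x ∧ C n + r ∈ Set.range C}.ncard

/-- `A` is a strictly increasing sequence of positive integers such that, for all real `x ≥ X`,
`A(x) ≍ x / η(x)` (with implied constants `K₁`, `K₂`), `A(x / 2) ≫ A(x)` (with implied
constant `K₃`) and `A(x, r) ≪ (r / φ(r)) x / η(x) ^ 2` for every positive integer `r` (with implied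
constant `K₄`). -/
structure SieveRegular (A : ℕ → ℕ) (η : ℝ → ℝ) (X K₁ K₂ K₃ K₄ : ℝ) : Prop where
  pos : ∀ n, 0 < A n
  strictMono : StrictMono A
  eta_pos : ∀ x : ℝ, X ≤ x → 0 < η x
  count_le : ∀ x : ℝ, X ≤ x → (countUpTo A x : ℝ) ≤ K₁ * (x / η x)
  le_count : ∀ x : ℝ, X ≤ x → x / η x ≤ K₂ * (countUpTo A x : ℝ)
  count_half : ∀ x : ℝ, X ≤ x → (countUpTo A x : ℝ) ≤ K₃ * (countUpTo A (x / 2) : ℝ)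
  count_shift : ∀ x : ℝ, X ≤ x → ∀ r : ℕ, 0 < r →
    (countShift A x r : ℝ) ≤ K₄ * ((r : ℝ) / (Nat.totient r : ℝ) * (x / η x ^ 2))

/-- `r(n)`: the number of pairs `(k, p)`, `p` prime, with `A k + a ^ f(p) = n`. The values of `f` at
positive integers are positive wherever this is used, so `Int.toNat` only changes the type. -/
noncomputable def reprCount (A : ℕ → ℕ) (a : ℕ) (f : Polynomial ℤ) (n : ℕ) : ℕ :=
  {q : ℕ × ℕ | q.2.Prime ∧ A q.1 + a ^ (f.eval (q.2 : ℤ)).toNat = n}.ncard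

/-! The proof is a second moment argument. Let P be the set of primes in (√Y, Y], with Y of order
(log x)^{1/d} chosen so that a^{f(p)} ≤ x/2 on P, and let N = |P|, of order Y / log Y. The pairs (k,
p) with A k ≤ x/2 number about xN/η(x), and their sums A k + a^{f(p)} are at most x. By
Cauchy–Schwarz (`sq_card_le_mul_card_popular`), an upper bound for the number E of coincidences
between two such sums yields many n with ≫ N/η(x) representations. What is needed is E ≪ (x/η)N +
(x/η²)N².

The diagonal f(p) = f(q) gives the first term. Off it, the sieve hypothesis gives (x/η²) r/φ(r) with
r = a^{f(p)} − a^{f(q)}, so r/φ(r) has to be bounded on average over p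
(`exists_sum_pow_sub_one_div_totient_le`). Up to the constant a/φ(a), this is the ratio for a^v − 1
with v = f(p) − f(q). Write H(e) = `orderProd a e`. A prime divides a^v − 1 only if the order of a
modulo it divides v, whence (a^v − 1)/φ(a^v − 1) ≤ 1 + ∑_{e ∣ v} (H(e) − H(e−1)). Summing over p
leaves the number of p in P with e ∣ f(p) − f(q), which is ≪ (Y / log Y) e^{-κ}
(`exists_card_largePrimes_dvd_le`). Since H(e) ≪ e^{κ/2}, that number is ≪ (Y / log Y)/H(e)², and ∑
(H(e) − H(e−1))/H(e)² is bounded by telescoping.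

The saving e^{-κ} combines a bound for the solutions of f(n) ≡ c (mod e), from Lagrange
interpolation, with a weak Brun–Titchmarsh inequality, from divisibility by factorials; the latter's
loss of log e is harmless against a power of e. -/

/-! ### Polynomial congruences in short intervals -/

open Polynomial in
/-- Among the integers of a short interval, a congruence `f(n) ≡ c (mod e)` has at most `deg f`
solutions. -/
theorem card_le_natDegree_of_dvd_eval_sub (f : ℤ[X]) (hd : 1 ≤ f.natDegree)
    (hlead : 0 < f.leadingCoeff) (e L : ℕ) (c : ℤ)
    (hL : f.leadingCoeff * (L : ℤ) ^ (f.natDegree * (f.natDegree + 1)) < e) (s : Finset ℕ)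
    (hs : ∀ n ∈ s, (e : ℤ) ∣ f.eval (n : ℤ) - c)
    (hdist : ∀ m ∈ s, ∀ n ∈ s, |(m : ℤ) - n| ≤ L) : s.card ≤ f.natDegree := by
  by_contra! hcard
  obtain ⟨t, hts, htc⟩ := Finset.exists_subset_card_eq (s := s) (n := f.natDegree + 1) hcard
  set g : ℤ[X] := f - C c with hg
  have hgd : g.natDegree = f.natDegree := by rw [hg, natDegree_sub_C]
  have hgl : g.leadingCoeff = f.leadingCoeff := by
    rw [hg, leadingCoeff_sub_of_degree_lt]
    exact degree_C_le.trans_lt (natDegree_pos_iff_degree_pos.1 hd)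
  have hg0 : g ≠ 0 := by
    rintro h
    rw [h, leadingCoeff_zero] at hgl
    omega
  have hinj : Function.Injective (Int.castRingHom ℚ) := Int.cast_injective
  -- With d + 1 solutions, interpolation writes the leading coefficient as ∑ (f(i) − c) / D i.
  -- Clearing denominators makes e divide a nonzero integer of size at most lead · L^{d(d+1)} < e.
  have key := Lagrange.leadingCoeff_eq_sum (s := t) (v := fun n : ℕ ↦ (n : ℚ))
    (fun a _ b _ h ↦ Nat.cast_injective h) (P := g.map (Int.castRingHom ℚ)) (by
      rw [degree_map_eq_of_injective hinj, degree_eq_natDegree hg0, hgd, htc]; norm_cast)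
  rw [leadingCoeff_map_of_injective hinj, hgl] at key
  set D : ℕ → ℤ := fun i ↦ ∏ j ∈ t.erase i, ((i : ℤ) - j) with hD
  have hD0 : ∀ i, D i ≠ 0 := fun i ↦ Finset.prod_ne_zero_iff.2 fun j hj ↦ by
    have := (Finset.mem_erase.1 hj).1
    omega
  have hfin : f.leadingCoeff * ∏ i ∈ t, D i
      = ∑ i ∈ t, g.eval (i : ℤ) * ∏ k ∈ t.erase i, D k := by
    have : ((f.leadingCoeff * ∏ i ∈ t, D i : ℤ) : ℚ)
        = ((∑ i ∈ t, g.eval (i : ℤ) * ∏ k ∈ t.erase i, D k : ℤ) : ℚ) := by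
      push_cast
      rw [show (f.leadingCoeff : ℚ) = (Int.castRingHom ℚ) f.leadingCoeff from rfl, key,
        Finset.sum_mul]
      refine Finset.sum_congr rfl fun i hi ↦ ?_
      have h1 : (∏ j ∈ t.erase i, ((i : ℚ) - j)) = (D i : ℚ) := by simp [hD]
      have h2 : (D i : ℚ) ≠ 0 := by exact_mod_cast hD0 i
      rw [h1, ← Finset.mul_prod_erase t _ hi]
      have h3 : (g.map (Int.castRingHom ℚ)).eval (i : ℚ) = ((g.eval (i : ℤ) : ℤ) : ℚ) := by
        simp
      rw [h3]
      field_simp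
    exact_mod_cast this
  have hdvd : (e : ℤ) ∣ f.leadingCoeff * ∏ i ∈ t, D i := by
    rw [hfin]
    refine Finset.dvd_sum fun i hi ↦ Dvd.dvd.mul_right ?_ _
    simpa [hg] using hs i (hts hi)
  have hle := Int.le_of_dvd (abs_pos.2 (mul_ne_zero hlead.ne'
    (Finset.prod_ne_zero_iff.2 fun i _ ↦ hD0 i))) ((dvd_abs _ _).2 hdvd)
  have hDle : ∀ i ∈ t, |D i| ≤ (L : ℤ) ^ f.natDegree := fun i hi ↦ by
    rw [hD, Finset.abs_prod]
    refine (Finset.prod_le_prod (fun _ _ ↦ abs_nonneg _) fun j hj ↦ hdist i (hts hi) j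
      (hts (Finset.mem_of_mem_erase hj))).trans ?_
    rw [Finset.prod_const, Finset.card_erase_of_mem hi, htc, Nat.add_sub_cancel]
  have : |∏ i ∈ t, D i| ≤ ((L : ℤ) ^ f.natDegree) ^ (f.natDegree + 1) := by
    rw [Finset.abs_prod, ← htc, ← Finset.prod_const]
    exact Finset.prod_le_prod (fun _ _ ↦ abs_nonneg _) hDle
  rw [abs_mul, abs_of_pos hlead] at hle
  rw [← pow_mul] at this
  nlinarith [mul_le_mul_of_nonneg_left this hlead.le]

open Polynomial in
/-- Quantitative bound for the number of solutions of `f(n) ≡ c (mod e)` in an interval. -/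
theorem card_filter_dvd_eval_sub_le (f : ℤ[X]) (hd : 1 ≤ f.natDegree)
    (hlead : 0 < f.leadingCoeff) (e : ℕ) (he : 1 ≤ e) (c : ℤ) (m N : ℕ) :
    (((Finset.Ico m (m + N)).filter fun n : ℕ ↦ (e : ℤ) ∣ f.eval (n : ℤ) - c).card : ℝ) ≤
      f.natDegree * (4 * N / ((e : ℝ) / f.leadingCoeff) ^
        (1 / ((f.natDegree * (f.natDegree + 1) : ℕ) : ℝ)) + 1) := by
  set D : ℕ := f.natDegree * (f.natDegree + 1) with hD
  have hDpos : 0 < D := by positivity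
  have hlr : (0 : ℝ) < f.leadingCoeff := by exact_mod_cast hlead
  have her : (0 : ℝ) < e := by exact_mod_cast he
  set t : ℝ := ((e : ℝ) / f.leadingCoeff) ^ (1 / (D : ℝ)) with ht
  have ht0 : 0 < t := Real.rpow_pos_of_pos (by positivity) _
  have htD : t ^ D = (e : ℝ) / f.leadingCoeff := by
    rw [ht, ← Real.rpow_natCast, ← Real.rpow_mul (by positivity), one_div_mul_cancel
      (by positivity), Real.rpow_one]
  have hd1 : (1 : ℝ) ≤ f.natDegree := by exact_mod_cast hd
  set S := (Finset.Ico m (m + N)).filter fun n : ℕ ↦ (e : ℤ) ∣ f.eval (n : ℤ) - c with hS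
  rcases lt_or_ge t 2 with h2 | h2
  · have h1 : (S.card : ℝ) ≤ N := by
      have : S.card ≤ N := (Finset.card_filter_le _ _).trans (by simp)
      exact_mod_cast this
    have h3 : (N : ℝ) ≤ 4 * N / t := by
      rw [le_div_iff₀ ht0]
      nlinarith [Nat.cast_nonneg (α := ℝ) N]
    nlinarith [Nat.cast_nonneg (α := ℝ) N]
  -- Cut the interval into blocks of length L; each block holds at most d solutions.
  · set L : ℕ := ⌊t / 2⌋₊ with hLdef
    have hL1 : 1 ≤ L := Nat.le_floor (by norm_num; linarith)
    have hLt : (L : ℝ) ≤ t / 2 := Nat.floor_le (by positivity)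
    have hLt' : t / 4 ≤ L := by
      have := Nat.lt_floor_add_one (t / 2)
      have h1 : (1 : ℝ) ≤ L := by exact_mod_cast hL1
      rw [← hLdef] at this
      linarith
    have hLD : f.leadingCoeff * (L : ℤ) ^ D < e := by
      have h1 : (L : ℝ) ^ D < (e : ℝ) / f.leadingCoeff := by
        rw [← htD]
        exact pow_lt_pow_left₀ (by linarith) (by positivity) hDpos.ne'
      rw [lt_div_iff₀ hlr, mul_comm] at h1
      exact_mod_cast h1
    have hcard : S.card ≤ f.natDegree * (S.image fun n ↦ (n - m) / L).card := by
      refine Finset.card_le_mul_card_image _ _ fun j _ ↦ ?_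
      refine card_le_natDegree_of_dvd_eval_sub f hd hlead e L c hLD _ (fun n hn ↦ ?_)
        fun n hn k hk ↦ ?_
      · exact (Finset.mem_filter.1 (Finset.mem_filter.1 hn).1).2
      · simp only [hS, Finset.mem_filter, Finset.mem_Ico] at hn hk
        have e1 := Nat.div_add_mod (n - m) L
        have e2 := Nat.div_add_mod (k - m) L
        have e3 := Nat.mod_lt (n - m) hL1
        have e4 := Nat.mod_lt (k - m) hL1
        rw [hn.2] at e1
        rw [hk.2] at e2
        rw [abs_le]
        constructor <;> omega
    have him : (S.image fun n ↦ (n - m) / L).card ≤ N / L + 1 := by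
      rw [← Finset.card_range (N / L + 1)]
      refine Finset.card_le_card fun j hj ↦ ?_
      obtain ⟨n, hn, rfl⟩ := Finset.mem_image.1 hj
      simp only [hS, Finset.mem_filter, Finset.mem_Ico] at hn
      rw [Finset.mem_range]
      exact Nat.lt_succ_of_le (Nat.div_le_div_right (by omega))
    have h5 : (S.card : ℝ) ≤ f.natDegree * ((N / L : ℕ) + 1) := by
      exact_mod_cast hcard.trans (Nat.mul_le_mul_left _ him)
    refine h5.trans (mul_le_mul_of_nonneg_left ?_ (by positivity))
    gcongr
    refine Nat.cast_div_le.trans ?_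
    rw [div_le_div_iff₀ (by exact_mod_cast hL1) ht0]
    nlinarith [Nat.cast_nonneg (α := ℝ) N]

-- The condition δ d ≤ 1 will absorb the summand 1 when e is as large as a constant times Y^d.
open Polynomial in
theorem exists_card_filter_dvd_eval_sub_le (f : ℤ[X]) (hd : 1 ≤ f.natDegree)
    (hlead : 0 < f.leadingCoeff) :
    ∃ C δ : ℝ, 0 < C ∧ 0 < δ ∧ δ * f.natDegree ≤ 1 ∧ ∀ (e : ℕ), 1 ≤ e → ∀ (c : ℤ) (m N : ℕ),
      (((Finset.Ico m (m + N)).filter fun n : ℕ ↦ (e : ℤ) ∣ f.eval (n : ℤ) - c).card : ℝ) ≤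
        C * (N * (e : ℝ) ^ (-δ) + 1) := by
  have hlr : (1 : ℝ) ≤ f.leadingCoeff := by exact_mod_cast hlead
  have hd1 : (1 : ℝ) ≤ f.natDegree := by exact_mod_cast hd
  set δ : ℝ := 1 / ((f.natDegree * (f.natDegree + 1) : ℕ) : ℝ) with hδ
  have hδ0 : 0 < δ := by rw [hδ]; push_cast; positivity
  refine ⟨4 * f.natDegree * (f.leadingCoeff : ℝ) ^ δ, δ, by positivity, hδ0, ?_, ?_⟩
  · rw [hδ, div_mul_eq_mul_div, div_le_one (by push_cast; positivity)]
    push_cast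
    nlinarith
  · intro e he c m N
    have her : (0 : ℝ) < e := by exact_mod_cast he
    refine (card_filter_dvd_eval_sub_le f hd hlead e he c m N).trans ?_
    rw [← hδ, Real.div_rpow her.le (by positivity), Real.rpow_neg her.le]
    have h1 : (1 : ℝ) ≤ (f.leadingCoeff : ℝ) ^ δ := Real.one_le_rpow hlr hδ0.le
    have h2 : 0 < (e : ℝ) ^ δ := by positivity
    rw [div_div_eq_mul_div]
    have h3 : 4 * (N : ℝ) * (f.leadingCoeff : ℝ) ^ δ / (e : ℝ) ^ δ
        = 4 * (f.leadingCoeff : ℝ) ^ δ * (N * ((e : ℝ) ^ δ)⁻¹) := by ring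
    rw [h3]
    nlinarith

/-! ### Chebyshev's upper bound and reciprocals of primes -/

theorem primeCounting_le_self (n : ℕ) : Nat.primeCounting n ≤ n := by
  induction n with
  | zero => simp
  | succ n ih =>
    have : Nat.primeCounting (n + 1) = Nat.primeCounting n + if (n + 1).Prime then 1 else 0 := by
      simp only [Nat.primeCounting, Nat.primeCounting', Nat.count_succ _ (n + 1)]
    split_ifs at this <;> omega

/-- Partial summation: if `π(n) ≤ ε n + C` then `∑ 1 / p ≤ ε log n + 2 C + 1`. -/
theorem sum_primes_inv_le_of_primeCounting_le (ε C : ℝ) (hε : 0 ≤ ε) (hC : 0 ≤ C)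
    (h : ∀ n : ℕ, (Nat.primeCounting n : ℝ) ≤ ε * n + C) (k : ℕ) :
    ∑ p ∈ (Finset.range (k + 2)).filter Nat.Prime, (1 / (p : ℝ)) ≤
      Nat.primeCounting (k + 1) / ((k + 1 : ℕ) : ℝ) + ε * Real.log ((k + 1 : ℕ) : ℝ)
        + C * (2 - 1 / ((k + 1 : ℕ) : ℝ)) := by
  induction k with
  | zero =>
    have : (Finset.range (0 + 2)).filter Nat.Prime = ∅ := by decide
    rw [this]
    simp
    linarith
  | succ k ih =>
    have hk : (0 : ℝ) < (k : ℝ) + 1 := by positivity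
    have hlog : 1 / ((k : ℝ) + 2) ≤ Real.log ((k : ℝ) + 2) - Real.log ((k : ℝ) + 1) := by
      have := Real.log_le_sub_one_of_pos (x := ((k : ℝ) + 1) / (k + 2)) (by positivity)
      rw [Real.log_div (by positivity) (by positivity)] at this
      have h2 : ((k : ℝ) + 1) / (k + 2) - 1 = - (1 / (k + 2)) := by field_simp; ring
      linarith
    have hpi : (Nat.primeCounting (k + 1 + 1) : ℝ)
        = Nat.primeCounting (k + 1) + if (k + 2).Prime then 1 else 0 := by
      simp only [Nat.primeCounting, Nat.primeCounting', Nat.count_succ _ (k + 1 + 1)]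
      push_cast
      rfl
    have hsum : ∑ p ∈ (Finset.range (k + 1 + 2)).filter Nat.Prime, (1 / (p : ℝ))
        = ∑ p ∈ (Finset.range (k + 2)).filter Nat.Prime, (1 / (p : ℝ))
          + (if (k + 2).Prime then 1 else 0) / ((k : ℝ) + 2) := by
      rw [show k + 1 + 2 = (k + 2) + 1 from rfl, Finset.range_add_one, Finset.filter_insert]
      split_ifs
      · rw [Finset.sum_insert (by simp)]
        push_cast
        ring
      · simp
    rw [hsum, hpi]
    push_cast at ih ⊢
    have hb := h (k + 1)
    push_cast at hb
    set π1 : ℝ := (Nat.primeCounting (k + 1) : ℝ)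
    set b : ℝ := if (k + 2).Prime then 1 else 0
    have e2 : (k : ℝ) + 1 + 1 = k + 2 := by ring
    rw [e2]
    -- The error C(1/(k+1) − 1/(k+2)) telescopes, which explains the term C(2 − 1/(k+1)) in the
    -- statement.
    have h1 : π1 / (k + 1) - π1 / (k + 2) ≤ (ε * (k + 1) + C) * (1 / (k + 1) - 1 / (k + 2)) := by
      have : (0 : ℝ) ≤ 1 / (k + 1) - 1 / (k + 2) := by
        rw [sub_nonneg]
        gcongr
        linarith
      calc π1 / (k + 1) - π1 / (k + 2) = π1 * (1 / (k + 1) - 1 / (k + 2)) := by ring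
        _ ≤ _ := mul_le_mul_of_nonneg_right hb this
    have h2 : (ε * (k + 1) + C) * (1 / ((k : ℝ) + 1) - 1 / (k + 2))
        = ε * (1 / (k + 2)) + C * (1 / (k + 1) - 1 / (k + 2)) := by
      field_simp
      ring
    have h3 := mul_le_mul_of_nonneg_left hlog hε
    rw [add_div]
    linarith

theorem exists_primeCounting_le :
    ∃ C : ℝ, 0 < C ∧ ∀ n : ℕ, 2 ≤ n → (Nat.primeCounting n : ℝ) ≤ C * (n / Real.log n) := by
  refine ⟨2 * Real.log 4 + 2, by positivity, fun n hn ↦ ?_⟩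
  have hn' : (2 : ℝ) ≤ n := by exact_mod_cast hn
  have h := Chebyshev.pi_le_log4_mul_div (x := (n : ℝ)) (by linarith)
  rw [Nat.floor_natCast, Real.log_sqrt (by positivity)] at h
  have hlog : 0 < Real.log n := Real.log_pos (by linarith)
  have h1 : Real.log n ≤ 2 * √(n : ℝ) := by
    have := Real.log_le_sub_one_of_pos (x := √(n : ℝ)) (by positivity)
    rw [Real.log_sqrt (by positivity)] at this
    linarith
  have h2 : √(n : ℝ) ≤ 2 * (n / Real.log n) := by
    rw [mul_div_assoc', le_div_iff₀ hlog]
    nlinarith [Real.sqrt_nonneg (n : ℝ), Real.mul_self_sqrt (show (0 : ℝ) ≤ n by positivity)]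
  calc _ ≤ _ := h
    _ ≤ 2 * Real.log 4 * (n / Real.log n) + 2 * (n / Real.log n) := by
        refine add_le_add (le_of_eq ?_) h2
        field_simp
    _ = _ := by ring

theorem exists_primeCounting_le_mul_add (ε : ℝ) (hε : 0 < ε) :
    ∃ C : ℝ, 0 ≤ C ∧ ∀ n : ℕ, (Nat.primeCounting n : ℝ) ≤ ε * n + C := by
  obtain ⟨C, hC, h⟩ := exists_primeCounting_le
  obtain ⟨N, hN⟩ := (((Real.tendsto_log_atTop.comp tendsto_natCast_atTop_atTop).eventually_ge_atTop
    (C / ε)).and (Filter.eventually_ge_atTop 2)).exists_forall_of_atTop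
  refine ⟨N, by positivity, fun n ↦ ?_⟩
  have hn0 : (0 : ℝ) ≤ n := by positivity
  rcases le_or_gt N n with hn | hn
  · obtain ⟨h1, h2⟩ := hN n hn
    refine (h n h2).trans ?_
    have hpos : 0 < C / ε := by positivity
    have hlog : 0 < Real.log n := hpos.trans_le h1
    have : C * (n / Real.log n) ≤ ε * n := by
      rw [mul_div_assoc', div_le_iff₀ hlog]
      have h3 : C ≤ ε * Real.log n := by
        rw [div_le_iff₀ hε, Function.comp_apply] at h1
        linarith
      nlinarith
    have : (0 : ℝ) ≤ N := by positivity
    linarith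
  · have h1 : (Nat.primeCounting n : ℝ) ≤ n := by
      exact_mod_cast primeCounting_le_self n
    have h2 : (n : ℝ) ≤ N := by exact_mod_cast hn.le
    nlinarith

/-- An arbitrarily small multiple of log k replaces the log log k of Mertens; it needs only π(n) =
o(n). -/
theorem exists_sum_primes_inv_le (ε : ℝ) (hε : 0 < ε) :
    ∃ C : ℝ, 0 ≤ C ∧ ∀ k : ℕ, 1 ≤ k →
      ∑ p ∈ (Finset.range (k + 1)).filter Nat.Prime, (1 / (p : ℝ)) ≤ ε * Real.log k + C := by
  obtain ⟨C, hC, h⟩ := exists_primeCounting_le_mul_add ε hε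
  refine ⟨1 + 2 * C, by positivity, fun k hk ↦ ?_⟩
  obtain ⟨k, rfl⟩ := Nat.exists_eq_add_of_le' hk
  refine (sum_primes_inv_le_of_primeCounting_le ε C hε.le hC h k).trans ?_
  have h1 : (Nat.primeCounting (k + 1) : ℝ) / ((k + 1 : ℕ) : ℝ) ≤ 1 := by
    rw [div_le_one (by positivity)]
    exact_mod_cast primeCounting_le_self (k + 1)
  have h2 : (0 : ℝ) ≤ C * (1 / ((k + 1 : ℕ) : ℝ)) := by positivity
  linarith

/-! ### The ratio m / φ(m) -/

theorem div_totient_eq_prod (m : ℕ) (hm : m ≠ 0) :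
    (m : ℝ) / Nat.totient m = ∏ p ∈ m.primeFactors, (1 - (p : ℝ)⁻¹)⁻¹ := by
  have h := Nat.totient_eq_mul_prod_factors m
  have h' : (Nat.totient m : ℝ) = m * ∏ p ∈ m.primeFactors, (1 - (p : ℝ)⁻¹) := by
    have := congrArg (fun q : ℚ ↦ (q : ℝ)) h
    push_cast at this
    exact this
  rw [h', Finset.prod_inv_distrib, div_mul_eq_div_div, div_self (by exact_mod_cast hm), one_div]

theorem one_sub_inv_inv_le_exp {p : ℕ} (hp : 2 ≤ p) :
    (1 - (p : ℝ)⁻¹)⁻¹ ≤ Real.exp (2 * (1 / (p : ℝ))) := by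
  have hp' : (2 : ℝ) ≤ p := by exact_mod_cast hp
  have h1 : (1 - (p : ℝ)⁻¹)⁻¹ ≤ 1 + 2 * (1 / (p : ℝ)) := by
    have h2 : (p : ℝ)⁻¹ ≤ 2⁻¹ := by gcongr
    have h3 : 0 < (p : ℝ)⁻¹ := by positivity
    rw [inv_le_iff_one_le_mul₀ (by linarith), one_div]
    nlinarith
  exact h1.trans (by linarith [Real.add_one_le_exp (2 * (1 / (p : ℝ)))])

theorem card_primeFactors_le_log (m : ℕ) (hm : m ≠ 0) :
    (m.primeFactors.card : ℝ) ≤ 2 * Real.log m := by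
  have h1 : 2 ^ m.primeFactors.card ≤ m := by
    calc 2 ^ m.primeFactors.card = ∏ p ∈ m.primeFactors, 2 := by simp
      _ ≤ ∏ p ∈ m.primeFactors, p :=
          Finset.prod_le_prod' fun p hp ↦ (Nat.prime_of_mem_primeFactors hp).two_le
      _ ≤ m := Nat.le_of_dvd (Nat.pos_of_ne_zero hm) (Nat.prod_primeFactors_dvd m)
  have h2 : (m.primeFactors.card : ℝ) * Real.log 2 ≤ Real.log m := by
    rw [← Real.log_pow]
    exact Real.log_le_log (by positivity) (by exact_mod_cast h1)
  nlinarith [Real.log_two_gt_d9, Nat.cast_nonneg (α := ℝ) m.primeFactors.card]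

/-- The logarithm of m/φ(m) is at most 2 ∑_{p ∣ m} 1/p. With k = ω(m) + 1 ≪ log m, the primes up to
k contribute at most (ε/2) log k + C to the sum, and the fewer than k others at most 1. -/
theorem exists_div_totient_le (ε : ℝ) (hε : 0 < ε) :
    ∃ C : ℝ, 0 < C ∧ ∀ m : ℕ, m ≠ 0 →
      (m : ℝ) / Nat.totient m ≤ C * (1 + 2 * Real.log m) ^ ε := by
  obtain ⟨C, hC, h⟩ := exists_sum_primes_inv_le (ε / 2) (by positivity)
  refine ⟨Real.exp (2 * (C + 1)), Real.exp_pos _, fun m hm ↦ ?_⟩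
  set k := m.primeFactors.card + 1 with hk
  have hk1 : (k : ℝ) ≤ 1 + 2 * Real.log m := by
    have := card_primeFactors_le_log m hm
    rw [hk]
    push_cast
    linarith
  have hkpos : (0 : ℝ) < k := by positivity
  have hsum : ∑ p ∈ m.primeFactors, (1 / (p : ℝ)) ≤ ε / 2 * Real.log k + C + 1 := by
    rw [← Finset.sum_filter_add_sum_filter_not m.primeFactors (· ≤ k)]
    refine add_le_add ?_ ?_
    · refine le_trans (Finset.sum_le_sum_of_subset_of_nonneg (fun p hp ↦ ?_) ?_) (h k (by omega))
      · rw [Finset.mem_filter] at hp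
        rw [Finset.mem_filter, Finset.mem_range]
        exact ⟨by omega, Nat.prime_of_mem_primeFactors hp.1⟩
      · intros; positivity
    · calc _ ≤ ∑ p ∈ m.primeFactors with ¬ p ≤ k, 1 / (k : ℝ) := by
            refine Finset.sum_le_sum fun p hp ↦ ?_
            have : k < p := not_le.1 (Finset.mem_filter.1 hp).2
            gcongr
        _ ≤ k * (1 / (k : ℝ)) := by
            rw [Finset.sum_const, nsmul_eq_mul]
            gcongr
            exact (Finset.card_filter_le _ _).trans (by omega)
        _ = 1 := by field_simp
  rw [div_totient_eq_prod m hm]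
  calc _ ≤ ∏ p ∈ m.primeFactors, Real.exp (2 * (1 / (p : ℝ))) := by
        refine Finset.prod_le_prod (fun p hp ↦ ?_) fun p hp ↦
          one_sub_inv_inv_le_exp (Nat.prime_of_mem_primeFactors hp).two_le
        have : (1 : ℝ) ≤ p := by exact_mod_cast (Nat.prime_of_mem_primeFactors hp).one_le
        rw [inv_nonneg, sub_nonneg]
        exact inv_le_one_of_one_le₀ this
    _ = Real.exp (2 * ∑ p ∈ m.primeFactors, (1 / (p : ℝ))) := by
        rw [Finset.mul_sum, Real.exp_sum]
    _ ≤ Real.exp (2 * (C + 1) + Real.log k * ε) := by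
        gcongr
        linarith
    _ = Real.exp (2 * (C + 1)) * (k : ℝ) ^ ε := by
        rw [Real.exp_add, Real.rpow_def_of_pos hkpos]
    _ ≤ _ := by gcongr

/-! ### Orders of a modulo primes and the ratio for a^v − 1 -/

/-- Primes dividing some `a ^ j - 1` with `1 ≤ j ≤ E`. -/
def orderPrimes (a E : ℕ) : Finset ℕ :=
  (Finset.Icc 1 E).biUnion fun j ↦ (a ^ j - 1).primeFactors

/-- `∏ (1 - 1 / q)⁻¹` over the primes `q` modulo which `a` has order at most `E`. -/
noncomputable def orderProd (a E : ℕ) : ℝ :=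
  ∏ q ∈ orderPrimes a E, (1 - (q : ℝ)⁻¹)⁻¹

theorem one_le_one_sub_inv_inv {p : ℕ} (hp : p.Prime) : (1 : ℝ) ≤ (1 - (p : ℝ)⁻¹)⁻¹ := by
  have h1 : (2 : ℝ) ≤ p := by exact_mod_cast hp.two_le
  have h2 : (p : ℝ)⁻¹ ≤ 2⁻¹ := by gcongr
  have h3 : 0 < (p : ℝ)⁻¹ := by positivity
  exact (one_le_inv₀ (by linarith)).2 (by linarith)

theorem mem_orderPrimes {a E q : ℕ} :
    q ∈ orderPrimes a E ↔ ∃ j, (1 ≤ j ∧ j ≤ E) ∧ q ∈ (a ^ j - 1).primeFactors := by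
  simp [orderPrimes]

theorem prime_of_mem_orderPrimes {a E q : ℕ} (h : q ∈ orderPrimes a E) : q.Prime := by
  obtain ⟨j, -, hj⟩ := mem_orderPrimes.1 h
  exact Nat.prime_of_mem_primeFactors hj

theorem orderPrimes_mono (a : ℕ) : Monotone (orderPrimes a) := fun E F h q hq ↦ by
  obtain ⟨j, ⟨h1, h2⟩, hj⟩ := mem_orderPrimes.1 hq
  exact mem_orderPrimes.2 ⟨j, ⟨h1, h2.trans h⟩, hj⟩

theorem orderProd_zero (a : ℕ) : orderProd a 0 = 1 := by
  simp [orderProd, orderPrimes]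

theorem orderProd_mono (a : ℕ) : Monotone (orderProd a) := fun E F h ↦ by
  refine Finset.prod_le_prod_of_subset_of_one_le (orderPrimes_mono a h) (fun q hq ↦ ?_)
    fun q hq _ ↦ ?_
  · exact zero_le_one.trans (one_le_one_sub_inv_inv (prime_of_mem_orderPrimes hq))
  · exact one_le_one_sub_inv_inv (prime_of_mem_orderPrimes hq)

theorem one_le_orderProd (a E : ℕ) : 1 ≤ orderProd a E :=
  (orderProd_zero a).symm.le.trans (orderProd_mono a (Nat.zero_le E))

theorem pow_sub_one_ne_zero {a j : ℕ} (ha : 2 ≤ a) (hj : 1 ≤ j) : a ^ j - 1 ≠ 0 := by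
  have := Nat.one_lt_pow (n := j) (by omega) (show 1 < a by omega)
  omega

/-- Induction on E. Primes new at level E + 1 are those modulo which a has order E + 1. If E + 1 ∣
v, all of them divide a^v − 1, and a product at most H(E) gains the factor H(E+1)/H(E). Otherwise
none divides a^v − 1, since a common prime factor of a^j − 1 and a^v − 1 divides a^{gcd(j,v)} − 1.
-/
theorem prod_inter_orderPrimes_le {a v : ℕ} (ha : 2 ≤ a) (hv : 1 ≤ v) (E : ℕ) :
    ∏ q ∈ (a ^ v - 1).primeFactors ∩ orderPrimes a E, (1 - (q : ℝ)⁻¹)⁻¹ ≤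
      1 + ∑ e ∈ (Finset.Icc 1 E).filter (· ∣ v), (orderProd a e - orderProd a (e - 1)) := by
  induction E with
  | zero => simp [orderPrimes]
  | succ E ih =>
    set S := (a ^ v - 1).primeFactors with hS
    by_cases hdvd : E + 1 ∣ v
    · have h1 : (Finset.Icc 1 (E + 1)).filter (· ∣ v)
          = insert (E + 1) ((Finset.Icc 1 E).filter (· ∣ v)) := by
        rw [← Finset.insert_Icc_right_eq_Icc_add_one (by omega), Finset.filter_insert, if_pos hdvd]
      set T := orderPrimes a (E + 1) \ orderPrimes a E with hT
      have hsub : orderPrimes a E ⊆ orderPrimes a (E + 1) := orderPrimes_mono a (Nat.le_succ E)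
      have hTS : T ⊆ S := fun q hq ↦ by
        obtain ⟨hq1, hq2⟩ := Finset.mem_sdiff.1 hq
        obtain ⟨j, ⟨hj1, hj2⟩, hj⟩ := mem_orderPrimes.1 hq1
        have hjE : j = E + 1 := by
          by_contra hne
          exact hq2 (mem_orderPrimes.2 ⟨j, ⟨hj1, by omega⟩, hj⟩)
        subst hjE
        exact Nat.primeFactors_mono (Nat.pow_sub_one_dvd_pow_sub_one a hdvd)
          (pow_sub_one_ne_zero ha hv) hj
      have h2 : S ∩ orderPrimes a (E + 1) = (S ∩ orderPrimes a E) ∪ T := by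
        ext q
        have := @hTS q
        have := @hsub q
        simp only [hT, Finset.mem_inter, Finset.mem_union, Finset.mem_sdiff] at *
        tauto
      have h3 : Disjoint (S ∩ orderPrimes a E) T :=
        Finset.disjoint_left.2 fun q h h' ↦
          (Finset.mem_sdiff.1 h').2 (Finset.mem_inter.1 h).2
      have hG : 1 ≤ ∏ q ∈ T, (1 - (q : ℝ)⁻¹)⁻¹ := by
        refine Finset.one_le_prod fun q hq ↦ one_le_one_sub_inv_inv
          (prime_of_mem_orderPrimes (Finset.mem_sdiff.1 hq).1)
      have hH : orderProd a (E + 1) = orderProd a E * ∏ q ∈ T, (1 - (q : ℝ)⁻¹)⁻¹ := by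
        rw [orderProd, orderProd, mul_comm, Finset.prod_sdiff hsub]
      have hB : ∏ q ∈ S ∩ orderPrimes a E, (1 - (q : ℝ)⁻¹)⁻¹ ≤ orderProd a E := by
        refine Finset.prod_le_prod_of_subset_of_one_le Finset.inter_subset_right
          (fun q hq ↦ ?_) fun q hq _ ↦ ?_
        · exact zero_le_one.trans (one_le_one_sub_inv_inv
            (prime_of_mem_orderPrimes (Finset.mem_inter.1 hq).2))
        · exact one_le_one_sub_inv_inv (prime_of_mem_orderPrimes hq)
      rw [h1, h2, Finset.prod_union h3, Finset.sum_insert (by simp), Nat.add_sub_cancel, hH]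
      nlinarith
    · have h1 : (Finset.Icc 1 (E + 1)).filter (· ∣ v) = (Finset.Icc 1 E).filter (· ∣ v) := by
        rw [← Finset.insert_Icc_right_eq_Icc_add_one (by omega), Finset.filter_insert, if_neg hdvd]
      have h2 : S ∩ orderPrimes a (E + 1) = S ∩ orderPrimes a E := by
        refine Finset.Subset.antisymm (fun q hq ↦ ?_)
          (Finset.inter_subset_inter_left (orderPrimes_mono a (Nat.le_succ E)))
        obtain ⟨hq1, hq2⟩ := Finset.mem_inter.1 hq
        refine Finset.mem_inter.2 ⟨hq1, ?_⟩
        obtain ⟨j, ⟨hj1, hj2⟩, hj⟩ := mem_orderPrimes.1 hq2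
        have hqp := Nat.prime_of_mem_primeFactors hj
        have hg : q ∣ a ^ (j.gcd v) - 1 := by
          rw [← Nat.pow_sub_one_gcd_pow_sub_one]
          exact Nat.dvd_gcd (Nat.dvd_of_mem_primeFactors hj) (Nat.dvd_of_mem_primeFactors hq1)
        have hg1 : 1 ≤ j.gcd v := Nat.gcd_pos_of_pos_left _ hj1
        refine mem_orderPrimes.2 ⟨j.gcd v, ⟨hg1, ?_⟩,
          Nat.mem_primeFactors.2 ⟨hqp, hg, pow_sub_one_ne_zero ha hg1⟩⟩
        have hle : j.gcd v ≤ j := Nat.gcd_le_left _ hj1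
        by_contra hlt
        have : j.gcd v = E + 1 := by omega
        exact hdvd (this ▸ Nat.gcd_dvd_right j v)
      rw [h1, h2]
      exact ih

theorem pow_sub_one_div_totient_le {a v : ℕ} (ha : 2 ≤ a) (hv : 1 ≤ v) (V : ℕ) (hV : v ≤ V) :
    ((a ^ v - 1 : ℕ) : ℝ) / Nat.totient (a ^ v - 1) ≤
      1 + ∑ e ∈ (Finset.Icc 1 V).filter (· ∣ v), (orderProd a e - orderProd a (e - 1)) := by
  rw [div_totient_eq_prod _ (pow_sub_one_ne_zero ha hv)]
  have h : (a ^ v - 1).primeFactors ∩ orderPrimes a V = (a ^ v - 1).primeFactors :=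
    Finset.inter_eq_left.2 fun q hq ↦ mem_orderPrimes.2 ⟨v, ⟨hv, hV⟩, hq⟩
  rw [← h]
  exact prod_inter_orderPrimes_le ha hv V

/-- The product is M/φ(M) for M = ∏_{j ≤ e} (a^j − 1) ≤ a^{e²}, so log M ≪ e² and the exponent κ/2
in the totient bound suffices. -/
theorem exists_orderProd_le {a : ℕ} (ha : 2 ≤ a) (κ : ℝ) (hκ : 0 < κ) :
    ∃ C : ℝ, 0 < C ∧ ∀ e : ℕ, 1 ≤ e → orderProd a e ≤ C * (e : ℝ) ^ κ := by
  obtain ⟨C, hC, h⟩ := exists_div_totient_le (κ / 2) (by positivity)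
  have hla : 0 < Real.log a := Real.log_pos (by exact_mod_cast (show 1 < a by omega))
  refine ⟨C * (1 + 2 * Real.log a) ^ (κ / 2), by positivity, fun e he ↦ ?_⟩
  have he' : (1 : ℝ) ≤ e := by exact_mod_cast he
  set M := ∏ j ∈ Finset.Icc 1 e, (a ^ j - 1) with hM
  have hM0 : M ≠ 0 := Finset.prod_ne_zero_iff.2 fun j hj ↦
    pow_sub_one_ne_zero ha (Finset.mem_Icc.1 hj).1
  have hpf : orderPrimes a e = M.primeFactors := by
    ext q
    rw [mem_orderPrimes, Nat.mem_primeFactors]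
    constructor
    · rintro ⟨j, hj, hq⟩
      exact ⟨Nat.prime_of_mem_primeFactors hq, (Nat.dvd_of_mem_primeFactors hq).trans
        (Finset.dvd_prod_of_mem _ (Finset.mem_Icc.2 hj)), hM0⟩
    · rintro ⟨hq, hqd, -⟩
      obtain ⟨j, hj, hqj⟩ := (Prime.dvd_finsetProd_iff hq.prime _).1 hqd
      have hj' := Finset.mem_Icc.1 hj
      exact ⟨j, hj', Nat.mem_primeFactors.2 ⟨hq, hqj, pow_sub_one_ne_zero ha hj'.1⟩⟩
  have hMle : M ≤ a ^ (e * e) := by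
    calc M ≤ ∏ j ∈ Finset.Icc 1 e, a ^ e := Finset.prod_le_prod' fun j hj ↦
          (Nat.sub_le _ _).trans (Nat.pow_le_pow_right (by omega) (Finset.mem_Icc.1 hj).2)
      _ = a ^ (e * e) := by simp [pow_mul]
  have hlog : Real.log M ≤ e * e * Real.log a := by
    have h1 : (M : ℝ) ≤ (a : ℝ) ^ (e * e) := by exact_mod_cast hMle
    have := Real.log_le_log (by exact_mod_cast Nat.pos_of_ne_zero hM0) h1
    rwa [Real.log_pow, Nat.cast_mul] at this
  have hlogM : 0 ≤ Real.log M := Real.log_natCast_nonneg M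
  rw [orderProd, hpf, ← div_totient_eq_prod M hM0]
  calc _ ≤ C * (1 + 2 * Real.log M) ^ (κ / 2) := h M hM0
    _ ≤ C * ((1 + 2 * Real.log a) * (e : ℝ) ^ (2 : ℝ)) ^ (κ / 2) := by
        gcongr
        rw [Real.rpow_two]
        nlinarith
    _ = _ := by
        rw [Real.mul_rpow (by positivity) (by positivity), ← Real.rpow_mul (by positivity)]
        ring_nf

/-! ### Primes in arithmetic progressions -/

theorem prod_Icc_add_eq_ascFactorial (c n : ℕ) :
    ∏ i ∈ Finset.Icc 1 n, (c + i) = (c + 1).ascFactorial n := by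
  induction n with
  | zero => simp
  | succ n ih =>
    rw [Finset.prod_Icc_succ_top (by omega), ih, Nat.ascFactorial_succ, mul_comm]
    ring

/-- The part of `n!` prime to `e` divides `∏_{i ≤ n} (b + i e)`. -/
theorem dvd_prod_add_mul_of_coprime {M n b e : ℕ} (hM : M ∣ n.factorial) (hMe : M.Coprime e)
    (hM0 : M ≠ 0) : M ∣ ∏ i ∈ Finset.Icc 1 n, (b + i * e) := by
  have : NeZero M := ⟨hM0⟩
  set u : (ZMod M)ˣ := ZMod.unitOfCoprime e hMe.symm with hu
  have hue : (u : ZMod M) = e := ZMod.coe_unitOfCoprime e hMe.symm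
  -- With c ≡ b/e modulo M, the product is e^n ∏ (c + i), and n! divides a product of n consecutive
  -- integers.
  set c : ℕ := ((u⁻¹ : (ZMod M)ˣ) * (b : ZMod M) : ZMod M).val with hc
  have hcb : (e : ZMod M) * c = b := by
    rw [hc, ZMod.natCast_zmod_val, ← hue, ← mul_assoc, Units.mul_inv, one_mul]
  rw [← ZMod.natCast_eq_zero_iff]
  have h1 : ((∏ i ∈ Finset.Icc 1 n, (b + i * e) : ℕ) : ZMod M)
      = (e : ZMod M) ^ n * ((∏ i ∈ Finset.Icc 1 n, (c + i) : ℕ) : ZMod M) := by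
    have hcard : (e : ZMod M) ^ n = ∏ i ∈ Finset.Icc 1 n, (e : ZMod M) := by simp
    push_cast
    rw [hcard, ← Finset.prod_mul_distrib]
    refine Finset.prod_congr rfl fun i _ ↦ ?_
    rw [mul_add, hcb]
    ring
  rw [h1, prod_Icc_add_eq_ascFactorial, (ZMod.natCast_eq_zero_iff _ _).2 (hM.trans (Nat.factorial_dvd_ascFactorial _ _)),
    mul_zero]

/-- For a prime l dividing e, the exponent of l in n! is at most n, hence at most its exponent in
e^n, so l is removed completely. -/
theorem factorial_div_gcd_pow_coprime (n e : ℕ) :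
    (n.factorial / n.factorial.gcd (e ^ n)).Coprime e := by
  rcases Nat.eq_zero_or_pos e with rfl | he
  · rcases Nat.eq_zero_or_pos n with rfl | hn
    · simp
    · rw [zero_pow hn.ne', Nat.gcd_zero_right, Nat.div_self (Nat.factorial_pos n)]
      simp
  refine Nat.coprime_of_dvd fun l hl h1 h2 ↦ ?_
  have hg : n.factorial.gcd (e ^ n) ∣ n.factorial := Nat.gcd_dvd_left _ _
  have hen : e ^ n ≠ 0 := (pow_pos he n).ne'
  have hn0 := Nat.factorial_ne_zero n
  have hpos : n.factorial / n.factorial.gcd (e ^ n) ≠ 0 :=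
    (Nat.div_pos (Nat.le_of_dvd (Nat.factorial_pos n) hg) (Nat.gcd_pos_of_pos_left _
      (Nat.factorial_pos n))).ne'
  have h3 : 0 < (n.factorial / n.factorial.gcd (e ^ n)).factorization l :=
    hl.factorization_pos_of_dvd hpos h1
  have h4 : n.factorial.factorization l ≤ n :=
    (Nat.factorization_factorial_le_div_pred hl n).trans (Nat.div_le_self _ _)
  have h5 : 1 ≤ e.factorization l := hl.factorization_pos_of_dvd he.ne' h2
  rw [Nat.factorization_div hg, Nat.factorization_gcd hn0 hen, Nat.factorization_pow] at h3
  simp only [Finsupp.coe_tsub, Pi.sub_apply, Finsupp.inf_apply, Finsupp.smul_apply,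
    smul_eq_mul] at h3
  have h6 : n ≤ n * e.factorization l := Nat.le_mul_of_pos_right _ h5
  omega

/-- The part M of n! prime to e divides ∏ (b + i e) and is coprime to its prime factors exceeding n.
So the product of these primes is at most ∏ (b + i e)/M, where ∏ (b + i e) ≤ (n+1)! e^n and M ≥
n!/e^n. -/
theorem prod_primes_add_mul_le (n b e : ℕ) (he : 1 ≤ e) (hb : b ≤ e) :
    ∏ i ∈ (Finset.Icc 1 n).filter (fun i ↦ n < b + i * e ∧ (b + i * e).Prime), (b + i * e) ≤
      (n + 1) * e ^ (2 * n) := by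
  set S := (Finset.Icc 1 n).filter (fun i ↦ n < b + i * e ∧ (b + i * e).Prime) with hS
  set G := n.factorial.gcd (e ^ n) with hG
  set M := n.factorial / G with hM
  have hGd : G ∣ n.factorial := Nat.gcd_dvd_left _ _
  have hMG : M * G = n.factorial := Nat.div_mul_cancel hGd
  have hM0 : M ≠ 0 := fun h ↦ Nat.factorial_ne_zero n (by rw [← hMG, h, zero_mul])
  have hGe : G ≤ e ^ n := Nat.gcd_le_right _ (pow_pos he n)
  have hdvd : M ∣ ∏ i ∈ Finset.Icc 1 n, (b + i * e) :=
    dvd_prod_add_mul_of_coprime (Dvd.intro _ hMG) (factorial_div_gcd_pow_coprime n e) hM0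
  have hcop : M.Coprime (∏ i ∈ S, (b + i * e)) := by
    refine Nat.Coprime.prod_right fun i hi ↦ ?_
    obtain ⟨-, h1, h2⟩ := Finset.mem_filter.1 hi
    refine Nat.Coprime.coprime_dvd_left (Dvd.intro _ hMG) ?_
    rw [Nat.coprime_comm, h2.coprime_iff_not_dvd, h2.dvd_factorial]
    exact not_le.2 h1
  have hmul : M * ∏ i ∈ S, (b + i * e) ≤ ∏ i ∈ Finset.Icc 1 n, (b + i * e) := by
    refine Nat.le_of_dvd (Finset.prod_pos fun i hi ↦ ?_)
      (hcop.mul_dvd_of_dvd_of_dvd hdvd (Finset.prod_dvd_prod_of_subset _ _ _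
        (Finset.filter_subset _ _)))
    have := (Finset.mem_Icc.1 hi).1
    positivity
  have hup : ∏ i ∈ Finset.Icc 1 n, (b + i * e) ≤ (n + 1) * n.factorial * e ^ n := by
    calc _ ≤ ∏ i ∈ Finset.Icc 1 n, ((i + 1) * e) :=
          Finset.prod_le_prod' fun i _ ↦ by nlinarith
      _ = (n + 1) * n.factorial * e ^ n := by
          have h1 : ∏ i ∈ Finset.Icc 1 n, (i + 1) = (n + 1) * n.factorial := by
            have h2 := Nat.factorial_mul_ascFactorial 1 n
            rw [← Nat.factorial_succ, Nat.add_comm n 1, ← h2, Nat.factorial_one, one_mul,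
              ← prod_Icc_add_eq_ascFactorial]
            exact Finset.prod_congr rfl fun i _ ↦ Nat.add_comm _ _
          rw [Finset.prod_mul_distrib, h1, Finset.prod_const, Nat.card_Icc, Nat.add_sub_cancel]
  have hfin : n.factorial * ∏ i ∈ S, (b + i * e) ≤ n.factorial * ((n + 1) * e ^ (2 * n)) := by
    calc _ = G * (M * ∏ i ∈ S, (b + i * e)) := by rw [← hMG]; ring
      _ ≤ e ^ n * ((n + 1) * n.factorial * e ^ n) := Nat.mul_le_mul hGe (hmul.trans hup)
      _ = _ := by ring
  exact Nat.le_of_mul_le_mul_left hfin (Nat.factorial_pos n)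

/-- A Brun–Titchmarsh type bound, weaker than the true one by a factor of size `log e`. -/
theorem exists_card_primes_modEq_le :
    ∃ C : ℝ, 0 < C ∧ ∀ Y e b : ℕ, 2 ≤ Y → 1 ≤ e → e * e ≤ Y →
      (((Finset.range (Y + 1)).filter fun p ↦ p.Prime ∧ Y < p * p ∧ p % e = b).card : ℝ) ≤
        C * (Y / e * (1 + Real.log e) / Real.log Y) := by
  obtain ⟨C, hC, hpi⟩ := exists_primeCounting_le
  refine ⟨4 * (C + 2), by positivity, fun Y e b hY he heY ↦ ?_⟩
  set T := (Finset.range (Y + 1)).filter fun p ↦ p.Prime ∧ Y < p * p ∧ p % e = b with hT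
  set n := Y / e with hn
  have hbe : b ≤ e ∨ T = ∅ := by
    refine (le_or_gt b e).imp_right fun h ↦ Finset.filter_eq_empty_iff.2 ?_
    rintro p - ⟨-, -, h1⟩
    have := Nat.mod_lt p he
    omega
  have her : (1 : ℝ) ≤ e := by exact_mod_cast he
  have hYr : (2 : ℝ) ≤ Y := by exact_mod_cast hY
  have hlogY : 0 < Real.log Y := Real.log_pos (by linarith)
  have hloge : 0 ≤ Real.log e := Real.log_nonneg her
  rcases hbe with hbe | hTe
  swap
  · rw [hTe]
    simp only [Finset.card_empty, Nat.cast_zero]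
    positivity
  have hen : e ≤ n := (Nat.le_div_iff_mul_le he).2 heY
  have hYn : Y < (n + 1) * e := by
    have := Nat.div_add_mod Y e
    have := Nat.mod_lt Y he
    rw [← hn] at *
    nlinarith
  have hn2 : 2 ≤ n := by
    by_contra! h
    have h1 : e = 1 := by omega
    rw [h1, Nat.div_one] at hn
    omega
  have hnr : (2 : ℝ) ≤ n := by exact_mod_cast hn2
  have hlogn : 0 < Real.log n := Real.log_pos (by linarith)
  have hlogYn : Real.log Y ≤ 4 * Real.log n := by
    have h1 : Y ≤ n ^ 4 := by
      have : (n + 1) ≤ n * n := by nlinarith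
      have : (n + 1) * e ≤ (n * n) * (n * n) := Nat.mul_le_mul this (by nlinarith)
      calc Y ≤ (n * n) * (n * n) := by omega
        _ = n ^ 4 := by ring
    have h2 : (Y : ℝ) ≤ (n : ℝ) ^ 4 := by exact_mod_cast h1
    have := Real.log_le_log (by linarith) h2
    rwa [Real.log_pow] at this
  set S := (Finset.Icc 1 n).filter (fun i ↦ n < b + i * e ∧ (b + i * e).Prime) with hS
  -- Primes up to n = Y / e are bounded by π(n) without using the congruence; the others are terms b
  -- + i e > n.
  have hsub : T ⊆ (Finset.range (n + 1)).filter Nat.Prime ∪ S.image fun i ↦ b + i * e := by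
    intro p hp
    obtain ⟨h0, h1, h2, h3⟩ := Finset.mem_filter.1 hp
    rw [Finset.mem_range] at h0
    rw [Finset.mem_union, Finset.mem_filter, Finset.mem_range, Finset.mem_image]
    by_cases hpn : p < n + 1
    · exact Or.inl ⟨hpn, h1⟩
    · right
      have hpe := Nat.div_add_mod p e
      rw [h3] at hpe
      have hep : e ≤ p := by nlinarith
      have heq : b + p / e * e = p := by rw [mul_comm (p / e)]; omega
      refine ⟨p / e, Finset.mem_filter.2 ⟨Finset.mem_Icc.2
        ⟨(Nat.one_le_div_iff he).2 hep, Nat.div_le_div_right (by omega)⟩, ?_⟩, heq⟩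
      rw [heq]
      exact ⟨by omega, h1⟩
  have hcard : (T.card : ℝ) ≤ Nat.primeCounting n + S.card := by
    have h1 := (Finset.card_le_card hsub).trans (Finset.card_union_le _ _)
    have h2 : ((Finset.range (n + 1)).filter Nat.Prime).card = Nat.primeCounting n := by
      rw [Nat.primeCounting, Nat.primeCounting', Nat.count_eq_card_filter_range]
    have h3 : (S.image fun i ↦ b + i * e).card ≤ S.card := Finset.card_image_le
    exact_mod_cast h1.trans (by omega)
  have hScard : (S.card : ℝ) ≤ n * (1 + 2 * Real.log e) / Real.log n := by
    rw [le_div_iff₀ hlogn]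
    have h1 : n ^ S.card ≤ (n + 1) * e ^ (2 * n) := by
      refine le_trans ?_ (prod_primes_add_mul_le n b e he hbe)
      rw [← Finset.prod_const]
      exact Finset.prod_le_prod' fun i hi ↦ (Finset.mem_filter.1 hi).2.1.le
    have h2 : (n : ℝ) ^ S.card ≤ ((n : ℝ) + 1) * (e : ℝ) ^ (2 * n) := by exact_mod_cast h1
    have h3 := Real.log_le_log (by positivity) h2
    rw [Real.log_pow, Real.log_mul (by positivity) (by positivity), Real.log_pow] at h3
    have h4 := Real.log_le_sub_one_of_pos (x := (n : ℝ) + 1) (by positivity)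
    push_cast at h3
    linarith
  have hnY : (n : ℝ) ≤ Y / e := Nat.cast_div_le
  calc (T.card : ℝ) ≤ C * (n / Real.log n) + n * (1 + 2 * Real.log e) / Real.log n :=
        hcard.trans (add_le_add (hpi n hn2) hScard)
    _ = n * (C + 1 + 2 * Real.log e) / Real.log n := by ring
    _ ≤ (Y / e) * ((C + 2) * (1 + Real.log e)) / (Real.log Y / 4) := by
        gcongr
        · nlinarith
        · linarith
    _ = _ := by field_simp

/-! ### Primes p with f(p) in a given residue class -/

/-- The primes in `(√Y, Y]`. -/
def largePrimes (Y : ℕ) : Finset ℕ :=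
  (Finset.range (Y + 1)).filter fun p ↦ p.Prime ∧ Y < p * p

theorem mem_largePrimes {Y p : ℕ} : p ∈ largePrimes Y ↔ p ≤ Y ∧ p.Prime ∧ Y < p * p := by
  simp [largePrimes]

theorem one_add_log_le_rpow {ε t : ℝ} (hε : 0 < ε) (ht : 1 ≤ t) :
    1 + Real.log t ≤ (1 + 1 / ε) * t ^ ε := by
  have h1 := Real.log_le_rpow_div (x := t) (by linarith) hε
  have h2 : 1 ≤ t ^ ε := Real.one_le_rpow ht hε.le
  have h3 : (1 + 1 / ε) * t ^ ε = t ^ ε + t ^ ε / ε := by ring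
  linarith

-- For e² ≤ Y, multiply the number of roots modulo e by the bound for primes in each class. For e² >
-- Y, forget primality: the lost factor log Y is at most 2(1 + log e), and half of the saving e^{-δ}
-- pays for it.
open Polynomial in
theorem exists_card_largePrimes_dvd_le (f : ℤ[X]) (hd : 1 ≤ f.natDegree)
    (hlead : 0 < f.leadingCoeff) (B : ℝ) (hB : 1 ≤ B) :
    ∃ C κ : ℝ, 0 < C ∧ 0 < κ ∧ ∀ Y e : ℕ, 2 ≤ Y → 1 ≤ e → (e : ℝ) ≤ B * (Y : ℝ) ^ f.natDegree →
      ∀ c : ℤ, (((largePrimes Y).filter fun p : ℕ ↦ (e : ℤ) ∣ f.eval (p : ℤ) - c).card : ℝ) ≤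
        C * (Y / Real.log Y) * (e : ℝ) ^ (-κ) := by
  obtain ⟨C₁, δ, hC₁, hδ, hδd, hroots⟩ := exists_card_filter_dvd_eval_sub_le f hd hlead
  obtain ⟨C₂, hC₂, hBT⟩ := exists_card_primes_modEq_le
  have hδ1 : δ ≤ 1 := by
    have : (1 : ℝ) ≤ f.natDegree := by exact_mod_cast hd
    nlinarith
  refine ⟨(2 * C₁ * C₂ + C₁ * (2 + B) * 2) * (1 + 1 / (δ / 2)), δ / 2, by positivity,
    by positivity, fun Y e hY he heB c ↦ ?_⟩
  set T := (largePrimes Y).filter fun p : ℕ ↦ (e : ℤ) ∣ f.eval (p : ℤ) - c with hT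
  have her : (1 : ℝ) ≤ e := by exact_mod_cast he
  have he0 : (0 : ℝ) < e := by linarith
  have hYr : (2 : ℝ) ≤ Y := by exact_mod_cast hY
  have hlogY : 0 < Real.log Y := Real.log_pos (by linarith)
  have hK := one_add_log_le_rpow (half_pos hδ) her
  have hloge : 0 ≤ Real.log e := Real.log_nonneg her
  set K := 1 + 1 / (δ / 2) with hKdef
  have hK0 : 0 < K := by positivity
  have hsplit : (e : ℝ) ^ (-δ) * (e : ℝ) ^ (δ / 2) = (e : ℝ) ^ (-(δ / 2)) := by
    rw [← Real.rpow_add he0]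
    ring_nf
  have hneg : (0 : ℝ) < (e : ℝ) ^ (-δ) := by positivity
  have key : (1 + Real.log e) * (e : ℝ) ^ (-δ) ≤ K * (e : ℝ) ^ (-(δ / 2)) := by
    rw [← hsplit]
    nlinarith
  rcases le_or_gt (e * e) Y with hsm | hbig
  · set R := (Finset.Ico 0 (0 + e)).filter fun n : ℕ ↦ (e : ℤ) ∣ f.eval (n : ℤ) - c with hR
    have hmap : ∀ p ∈ T, p % e ∈ R := fun p hp ↦ by
      rw [hR, Finset.mem_filter, Finset.mem_Ico]
      refine ⟨⟨Nat.zero_le _, by simpa using Nat.mod_lt p he⟩, ?_⟩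
      have h1 := (Finset.mem_filter.1 hp).2
      have h2 : (e : ℤ) ∣ f.eval ((p % e : ℕ) : ℤ) - f.eval (p : ℤ) := by
        refine dvd_trans ?_ (sub_dvd_eval_sub _ _ f)
        push_cast
        rw [← dvd_neg, neg_sub]
        exact Int.dvd_self_sub_emod
      have := dvd_add h2 h1
      rwa [sub_add_sub_cancel] at this
    have h1 : (T.card : ℝ) ≤ R.card * (C₂ * (Y / e * (1 + Real.log e) / Real.log Y)) := by
      rw [Finset.card_eq_sum_card_fiberwise hmap]
      push_cast
      rw [← nsmul_eq_mul]
      refine Finset.sum_le_card_nsmul _ _ _ fun b _ ↦ le_trans ?_ (hBT Y e b hY he hsm)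
      refine Nat.cast_le.2 (Finset.card_le_card fun p hp ↦ ?_)
      rw [Finset.mem_filter, hT, Finset.mem_filter, mem_largePrimes] at hp
      rw [Finset.mem_filter, Finset.mem_range]
      exact ⟨by omega, hp.1.1.2.1, hp.1.1.2.2, hp.2⟩
    have h2 : (R.card : ℝ) ≤ C₁ * (2 * (e * (e : ℝ) ^ (-δ))) := by
      refine (hroots e he c 0 e).trans ?_
      have : (1 : ℝ) ≤ e * (e : ℝ) ^ (-δ) := by
        nth_rewrite 1 [← Real.rpow_one (e : ℝ)]
        rw [← Real.rpow_add he0]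
        exact Real.one_le_rpow her (by linarith)
      gcongr
      linarith
    calc (T.card : ℝ) ≤ C₁ * (2 * (e * (e : ℝ) ^ (-δ))) *
          (C₂ * (Y / e * (1 + Real.log e) / Real.log Y)) := h1.trans (by gcongr)
      _ = 2 * C₁ * C₂ * (Y / Real.log Y) * ((1 + Real.log e) * (e : ℝ) ^ (-δ)) := by
          field_simp
      _ ≤ 2 * C₁ * C₂ * (Y / Real.log Y) * (K * (e : ℝ) ^ (-(δ / 2))) := by gcongr
      _ = 2 * C₁ * C₂ * (K * (Y / Real.log Y) * (e : ℝ) ^ (-(δ / 2))) := by ring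
      _ ≤ (2 * C₁ * C₂ + C₁ * (2 + B) * 2) * (K * (Y / Real.log Y) * (e : ℝ) ^ (-(δ / 2))) := by
          gcongr
          have : 0 < C₁ * (2 + B) * 2 := by positivity
          linarith
      _ = _ := by ring
  · have h1 : (T.card : ℝ) ≤ C₁ * (((Y + 1 : ℕ) : ℝ) * (e : ℝ) ^ (-δ) + 1) := by
      refine le_trans (Nat.cast_le.2 (Finset.card_le_card fun p hp ↦ ?_))
        (hroots e he c 0 (Y + 1))
      rw [hT, Finset.mem_filter, mem_largePrimes] at hp
      rw [Finset.mem_filter, Finset.mem_Ico]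
      exact ⟨by omega, hp.2⟩
    -- Absorbs the summand 1 of the root count: e ≤ B Y^d and δ d ≤ 1 give e^δ ≤ B Y.
    have h2 : 1 ≤ B * Y * (e : ℝ) ^ (-δ) := by
      rw [Real.rpow_neg he0.le, ← div_eq_mul_inv, one_le_div (by positivity)]
      calc (e : ℝ) ^ δ ≤ (B * (Y : ℝ) ^ f.natDegree) ^ δ := by gcongr
        _ = B ^ δ * (Y : ℝ) ^ (δ * f.natDegree) := by
            rw [Real.mul_rpow (by positivity) (by positivity), ← Real.rpow_natCast,
              ← Real.rpow_mul (by positivity), mul_comm δ]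
        _ ≤ B ^ (1 : ℝ) * (Y : ℝ) ^ (1 : ℝ) := by
            gcongr
            linarith
        _ = B * Y := by simp
    have h3 : Real.log Y ≤ 2 * (1 + Real.log e) := by
      have h4 : (Y : ℝ) ≤ (e : ℝ) ^ 2 := by
        rw [sq]
        exact_mod_cast hbig.le
      have := Real.log_le_log (by linarith) h4
      rw [Real.log_pow] at this
      push_cast at this
      linarith
    calc (T.card : ℝ) ≤ C₁ * ((2 + B) * Y * (e : ℝ) ^ (-δ)) := by
          refine h1.trans ?_
          gcongr
          push_cast
          nlinarith
      _ = C₁ * (2 + B) * (Y / Real.log Y) * (Real.log Y * (e : ℝ) ^ (-δ)) := by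
          field_simp
      _ ≤ C₁ * (2 + B) * (Y / Real.log Y) * (2 * (1 + Real.log e) * (e : ℝ) ^ (-δ)) := by
          gcongr
      _ = C₁ * (2 + B) * 2 * (Y / Real.log Y) * ((1 + Real.log e) * (e : ℝ) ^ (-δ)) := by ring
      _ ≤ C₁ * (2 + B) * 2 * (Y / Real.log Y) * (K * (e : ℝ) ^ (-(δ / 2))) := by gcongr
      _ = C₁ * (2 + B) * 2 * (K * (Y / Real.log Y) * (e : ℝ) ^ (-(δ / 2))) := by ring
      _ ≤ (2 * C₁ * C₂ + C₁ * (2 + B) * 2) * (K * (Y / Real.log Y) * (e : ℝ) ^ (-(δ / 2))) := by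
          gcongr
          have : 0 < 2 * C₁ * C₂ := by positivity
          linarith
      _ = _ := by ring

/-! ### The average of the totient ratio over p -/

/-- Each term is at most 1/H(e−1) − 1/H(e), because H(e) ≥ H(e−1), and the sum telescopes. -/
theorem sum_sub_div_sq_le_one (H : ℕ → ℝ) (h0 : H 0 = 1) (hH : Monotone H) (V : ℕ) :
    ∑ e ∈ Finset.Icc 1 V, (H e - H (e - 1)) / H e ^ 2 ≤ 1 - 1 / H V := by
  have hpos : ∀ e, 0 < H e := fun e ↦ by linarith [hH (Nat.zero_le e)]
  induction V with
  | zero => simp [h0]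
  | succ V ih =>
    rw [Finset.sum_Icc_succ_top (by omega), Nat.add_sub_cancel]
    have h1 := hpos V
    have h2 := hpos (V + 1)
    have h3 := hH (Nat.le_succ V)
    have : (H (V + 1) - H V) / H (V + 1) ^ 2 ≤ 1 / H V - 1 / H (V + 1) := by
      rw [div_sub_div _ _ h1.ne' h2.ne', div_le_div_iff₀ (by positivity) (by positivity)]
      nlinarith [mul_nonneg (mul_nonneg (sub_nonneg.2 h3) (sub_nonneg.2 h3)) h2.le]
    linarith

open Polynomial in
theorem exists_sum_pow_sub_one_div_totient_le (a : ℕ) (ha : 2 ≤ a) (f : ℤ[X])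
    (hd : 1 ≤ f.natDegree) (hlead : 0 < f.leadingCoeff) (B : ℝ) (hB : 1 ≤ B) :
    ∃ C : ℝ, 0 < C ∧ ∀ Y : ℕ, 2 ≤ Y →
      (∀ p ∈ largePrimes Y, 0 < f.eval (p : ℤ) ∧
        ((f.eval (p : ℤ) : ℤ) : ℝ) ≤ B * (Y : ℝ) ^ f.natDegree) →
      ((largePrimes Y).card : ℝ) ≤ C * (Y / Real.log Y) ∧
      ∀ q ∈ largePrimes Y,
        ∑ p ∈ (largePrimes Y).filter fun p : ℕ ↦ f.eval (q : ℤ) < f.eval (p : ℤ),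
          ((a ^ ((f.eval (p : ℤ)).toNat - (f.eval (q : ℤ)).toNat) - 1 : ℕ) : ℝ) /
            Nat.totient (a ^ ((f.eval (p : ℤ)).toNat - (f.eval (q : ℤ)).toNat) - 1) ≤
        C * (Y / Real.log Y) := by
  obtain ⟨C, κ, hC, hκ, hN⟩ := exists_card_largePrimes_dvd_le f hd hlead B hB
  obtain ⟨C', hC', hH⟩ := exists_orderProd_le ha (κ / 2) (half_pos hκ)
  refine ⟨C + C * C' ^ 2, by positivity, fun Y hY hf ↦ ?_⟩
  have hYr : (2 : ℝ) ≤ Y := by exact_mod_cast hY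
  have hlogY : 0 < Real.log Y := Real.log_pos (by linarith)
  have hM : 0 < (Y : ℝ) / Real.log Y := by positivity
  have hBY : 1 ≤ B * (Y : ℝ) ^ f.natDegree := by
    have : (1 : ℝ) ≤ (Y : ℝ) ^ f.natDegree := one_le_pow₀ (by linarith)
    nlinarith
  have hcard : ((largePrimes Y).card : ℝ) ≤ C * (Y / Real.log Y) := by
    have := hN Y 1 hY le_rfl (by simpa using hBY) 0
    simpa using this
  refine ⟨hcard.trans ?_, fun q hq ↦ ?_⟩
  · rw [add_mul]
    have : 0 < C * C' ^ 2 * (Y / Real.log Y) := by positivity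
    linarith
  set Q := (largePrimes Y).filter fun p : ℕ ↦ f.eval (q : ℤ) < f.eval (p : ℤ) with hQ
  set v : ℕ → ℕ := fun p ↦ (f.eval (p : ℤ)).toNat - (f.eval (q : ℤ)).toNat with hv
  set V := ⌊B * (Y : ℝ) ^ f.natDegree⌋₊ with hV
  have hq0 := (hf q hq).1
  have hvV : ∀ p ∈ Q, 1 ≤ v p ∧ v p ≤ V ∧ ((v p : ℕ) : ℤ) = f.eval (p : ℤ) - f.eval (q : ℤ) := by
    intro p hp
    obtain ⟨hp1, hp2⟩ := Finset.mem_filter.1 hp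
    obtain ⟨hp3, hp4⟩ := hf p hp1
    refine ⟨by simp only [hv]; omega, ?_, by simp only [hv]; omega⟩
    refine Nat.le_floor (le_trans ?_ hp4)
    have : ((v p : ℕ) : ℤ) ≤ f.eval (p : ℤ) := by simp only [hv]; omega
    exact_mod_cast this
  have hmono := orderProd_mono a
  calc _ ≤ ∑ p ∈ Q, (1 + ∑ e ∈ (Finset.Icc 1 V).filter (· ∣ v p),
        (orderProd a e - orderProd a (e - 1))) := Finset.sum_le_sum fun p hp ↦
        pow_sub_one_div_totient_le ha (hvV p hp).1 V (hvV p hp).2.1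
    _ = Q.card + ∑ e ∈ Finset.Icc 1 V, (orderProd a e - orderProd a (e - 1)) *
          ((Q.filter fun p ↦ e ∣ v p).card : ℝ) := by
        rw [Finset.sum_add_distrib]
        congr 1
        · simp
        · simp_rw [Finset.sum_filter]
          rw [Finset.sum_comm]
          refine Finset.sum_congr rfl fun e _ ↦ ?_
          rw [← Finset.sum_filter, Finset.sum_const, nsmul_eq_mul, mul_comm]
    _ ≤ C * (Y / Real.log Y) + ∑ e ∈ Finset.Icc 1 V,
          (C * C' ^ 2 * (Y / Real.log Y)) *
            ((orderProd a e - orderProd a (e - 1)) / orderProd a e ^ 2) := by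
        refine add_le_add (le_trans ?_ hcard) (Finset.sum_le_sum fun e he ↦ ?_)
        · exact_mod_cast Finset.card_filter_le _ _
        obtain ⟨he1, heV⟩ := Finset.mem_Icc.1 he
        have he0 : (0 : ℝ) < e := by exact_mod_cast he1
        have hHe := hH e he1
        have hH1 := one_le_orderProd a e
        have hsub : 0 ≤ orderProd a e - orderProd a (e - 1) :=
          sub_nonneg.2 (hmono (Nat.sub_le e 1))
        have hNe : ((Q.filter fun p ↦ e ∣ v p).card : ℝ) ≤
            C * (Y / Real.log Y) * (e : ℝ) ^ (-κ) := by
          refine le_trans (Nat.cast_le.2 (Finset.card_le_card fun p hp ↦ ?_))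
            (hN Y e hY he1 ((Nat.le_floor_iff (by linarith)).1 heV) (f.eval (q : ℤ)))
          obtain ⟨hp1, hp2⟩ := Finset.mem_filter.1 hp
          refine Finset.mem_filter.2 ⟨(Finset.mem_filter.1 hp1).1, ?_⟩
          rw [← (hvV p hp1).2.2]
          exact_mod_cast hp2
        -- The growth exponent κ/2 of `orderProd` was chosen so that its square is beaten by the
        -- saving e^{-κ}.
        have hpow : (e : ℝ) ^ (-κ) ≤ C' ^ 2 / orderProd a e ^ 2 := by
          rw [le_div_iff₀ (by positivity)]
          calc (e : ℝ) ^ (-κ) * orderProd a e ^ 2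
              ≤ (e : ℝ) ^ (-κ) * (C' * (e : ℝ) ^ (κ / 2)) ^ 2 := by gcongr
            _ = C' ^ 2 * ((e : ℝ) ^ (-κ) * ((e : ℝ) ^ (κ / 2)) ^ (2 : ℝ)) := by
                rw [Real.rpow_two]; ring
            _ = C' ^ 2 := by
                rw [← Real.rpow_mul he0.le, ← Real.rpow_add he0]
                ring_nf
                simp
        calc _ ≤ (orderProd a e - orderProd a (e - 1)) *
              (C * (Y / Real.log Y) * (C' ^ 2 / orderProd a e ^ 2)) := by
              refine mul_le_mul_of_nonneg_left (hNe.trans ?_) hsub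
              gcongr
          _ = _ := by ring
    _ ≤ C * (Y / Real.log Y) + C * C' ^ 2 * (Y / Real.log Y) * 1 := by
        rw [← Finset.mul_sum]
        gcongr
        refine (sum_sub_div_sq_le_one _ (orderProd_zero a) hmono V).trans ?_
        have : 0 < 1 / orderProd a V := by
          have := one_le_orderProd a V
          positivity
        linarith
    _ = _ := by ring

/-! ### A lower bound for the number of primes, and values of f -/

theorem exists_le_card_largePrimes :
    ∃ Y₀ : ℕ, 2 ≤ Y₀ ∧ ∀ Y : ℕ, Y₀ ≤ Y →
      1 / 4 * (Y / Real.log Y) ≤ ((largePrimes Y).card : ℝ) := by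
  -- In terms of s = Y^{1/4} ≥ 100, discarding the primes up to √Y costs s² log Y ≤ 4s³ ≤ 0.04 Y,
  -- which fits between 1/4 and log 2.
  refine ⟨100 ^ 4, by norm_num, fun Y hY ↦ ?_⟩
  have hYr : (100 : ℝ) ^ 4 ≤ Y := by exact_mod_cast hY
  have hlogY : 0 < Real.log Y := Real.log_pos (by linarith)
  set s : ℝ := (Y : ℝ) ^ (1 / 4 : ℝ) with hs
  have hs4 : s ^ 4 = Y := by
    rw [hs, ← Real.rpow_natCast, ← Real.rpow_mul (by positivity)]
    norm_num
  have hs100 : 100 ≤ s := by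
    have hs0 : 0 ≤ s := by positivity
    by_contra! h
    have := pow_lt_pow_left₀ h hs0 (n := 4) (by norm_num)
    linarith
  have hlogs : Real.log Y ≤ 4 * s := by
    have := Real.log_le_rpow_div (x := (Y : ℝ)) (by positivity) (show (0 : ℝ) < 1 / 4 by norm_num)
    rw [← hs] at this
    linarith
  have hlog1 : Real.log ((Y : ℝ) + 1) ≤ 8 * s := by
    have h1 : (Y : ℝ) + 1 ≤ (Y : ℝ) ^ 2 := by nlinarith
    have := Real.log_le_log (by positivity) h1
    rw [Real.log_pow] at this
    push_cast at this
    linarith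
  have hpi := Chebyshev.pi_ge Y
  have hsub : (Finset.range (Y + 1)).filter Nat.Prime ⊆
      largePrimes Y ∪ Finset.Icc 1 (Nat.sqrt Y) := fun p hp ↦ by
    obtain ⟨h1, h2⟩ := Finset.mem_filter.1 hp
    rw [Finset.mem_range] at h1
    rw [Finset.mem_union, mem_largePrimes, Finset.mem_Icc]
    by_cases h : Y < p * p
    · exact Or.inl ⟨by omega, h2, h⟩
    · exact Or.inr ⟨h2.one_le, Nat.le_sqrt.2 (not_lt.1 h)⟩
  have hcard : (Nat.primeCounting Y : ℝ) ≤ (largePrimes Y).card + Nat.sqrt Y := by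
    have h1 := (Finset.card_le_card hsub).trans (Finset.card_union_le _ _)
    have h2 : ((Finset.range (Y + 1)).filter Nat.Prime).card = Nat.primeCounting Y := by
      rw [Nat.primeCounting, Nat.primeCounting', Nat.count_eq_card_filter_range]
    rw [h2, Nat.card_Icc, Nat.add_sub_cancel] at h1
    exact_mod_cast h1
  have hsqrt : (Nat.sqrt Y : ℝ) ≤ s ^ 2 := by
    have h1 : ((Nat.sqrt Y : ℝ)) ^ 2 ≤ Y := by exact_mod_cast Nat.sqrt_le' Y
    refine abs_le_of_sq_le_sq' (by nlinarith [hs4]) (by positivity) |>.2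
  have hmain : 1 / 4 * (Y / Real.log Y) + s ^ 2 ≤
      (Y * Real.log 2 - Real.log ((Y : ℝ) + 1)) / Real.log Y := by
    rw [le_div_iff₀ hlogY]
    have h1 : (1 / 4 * (Y / Real.log Y) + s ^ 2) * Real.log Y
        = 1 / 4 * Y + s ^ 2 * Real.log Y := by
      field_simp
    rw [h1]
    have h2 : s ^ 2 * Real.log Y ≤ s ^ 2 * (4 * s) := by gcongr
    have h3 : 0.69 * (Y : ℝ) ≤ Y * Real.log 2 := by
      nlinarith [Real.log_two_gt_d9]
    have h4 : s ^ 2 * (4 * s) ≤ 0.04 * (Y : ℝ) := by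
      rw [← hs4]
      nlinarith [pow_pos (show 0 < s by linarith) 3]
    have h5 : 8 * s ≤ 0.04 * (Y : ℝ) := by
      have : s ≤ s ^ 2 := by nlinarith
      nlinarith
    linarith
  linarith

open Polynomial in
theorem card_le_natDegree_of_eval_eq (f : ℤ[X]) (hd : 1 ≤ f.natDegree) (c : ℤ) (s : Finset ℕ)
    (hs : ∀ n ∈ s, f.eval (n : ℤ) = c) : s.card ≤ f.natDegree := by
  have h0 : f - C c ≠ 0 := fun h ↦ by
    have := natDegree_sub_C (p := f) (a := c)
    rw [h, natDegree_zero] at this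
    omega
  have h1 : s.map Nat.castEmbedding ⊆ (f - C c).roots.toFinset := fun z hz ↦ by
    obtain ⟨n, hn, rfl⟩ := Finset.mem_map.1 hz
    rw [Multiset.mem_toFinset, mem_roots h0, IsRoot.def]
    simp [hs n hn]
  calc s.card = (s.map (Nat.castEmbedding (R := ℤ))).card := (Finset.card_map _).symm
    _ ≤ _ := Finset.card_le_card h1
    _ ≤ (f - C c).roots.card := Multiset.toFinset_card_le _
    _ ≤ (f - C c).natDegree := card_roots' _
    _ = f.natDegree := natDegree_sub_C

open Polynomial in
theorem exists_eval_le_mul_pow (f : ℤ[X]) :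
    ∃ B : ℝ, 1 ≤ B ∧ ∀ n : ℕ, 1 ≤ n →
      ((f.eval (n : ℤ) : ℤ) : ℝ) ≤ B * (n : ℝ) ^ f.natDegree := by
  have h0 : (0 : ℝ) ≤ ∑ i ∈ Finset.range (f.natDegree + 1), |(f.coeff i : ℝ)| :=
    Finset.sum_nonneg fun _ _ ↦ abs_nonneg _
  refine ⟨1 + ∑ i ∈ Finset.range (f.natDegree + 1), |(f.coeff i : ℝ)|, by linarith,
    fun n hn ↦ ?_⟩
  have hn' : (1 : ℝ) ≤ n := by exact_mod_cast hn
  rw [eval_eq_sum_range, add_mul, Finset.sum_mul]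
  push_cast
  have h1 : (0 : ℝ) ≤ 1 * (n : ℝ) ^ f.natDegree := by positivity
  have h2 : ∑ i ∈ Finset.range (f.natDegree + 1), (f.coeff i : ℝ) * (n : ℝ) ^ i ≤
      ∑ i ∈ Finset.range (f.natDegree + 1), |(f.coeff i : ℝ)| * (n : ℝ) ^ f.natDegree := by
    refine Finset.sum_le_sum fun i hi ↦ ?_
    rw [Finset.mem_range] at hi
    exact mul_le_mul (le_abs_self _) (pow_le_pow_right₀ hn' (by omega)) (by positivity)
      (abs_nonneg _)
  linarith

/-! ### Second moment and coincidences -/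

/-- Second moment method: a map `g : Q → I` with few coincidences has many popular values. -/
theorem sq_card_le_mul_card_popular {ι : Type*} (Q : Finset ι) (g : ι → ℕ)
    (I : Finset ℕ) (hg : ∀ u ∈ Q, g u ∈ I) (x : ℝ) (hx : 0 < x) (hI : (I.card : ℝ) ≤ x) :
    (Q.card : ℝ) ^ 2 ≤ 4 * (((Q ×ˢ Q).filter fun w ↦ g w.1 = g w.2).card : ℝ) *
      ((I.filter fun n ↦ (Q.card : ℝ) / (2 * x) ≤ ((Q.filter fun u ↦ g u = n).card : ℝ)).card :
        ℝ) := by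
  set r : ℕ → ℝ := fun n ↦ ((Q.filter fun u ↦ g u = n).card : ℝ) with hr
  set J := I.filter fun n ↦ (Q.card : ℝ) / (2 * x) ≤ r n with hJ
  have hsum : ∑ n ∈ I, r n = Q.card := by
    rw [Finset.card_eq_sum_card_fiberwise hg]
    push_cast
    rfl
  have hE : ∑ n ∈ I, r n ^ 2 = (((Q ×ˢ Q).filter fun w ↦ g w.1 = g w.2).card : ℝ) := by
    rw [Finset.card_eq_sum_card_fiberwise (f := fun w ↦ g w.1) (t := I) fun w hw ↦
      hg _ (Finset.mem_product.1 (Finset.mem_filter.1 hw).1).1]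
    push_cast
    refine Finset.sum_congr rfl fun n _ ↦ ?_
    simp only [hr]
    rw [sq, ← Nat.cast_mul, ← Finset.card_product]
    congr 2
    ext ⟨u, w⟩
    simp only [Finset.mem_product, Finset.mem_filter]
    constructor
    · rintro ⟨⟨h1, h2⟩, h3, h4⟩
      exact ⟨⟨⟨h1, h3⟩, h2.trans h4.symm⟩, h2⟩
    · rintro ⟨⟨⟨h1, h3⟩, h4⟩, h2⟩
      exact ⟨⟨h1, h2⟩, h3, h4.symm.trans h2⟩
  -- Unpopular values carry at most half of the mass; Cauchy–Schwarz is then applied to the popular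
  -- ones alone.
  have hsmall : ∑ n ∈ I with ¬ (Q.card : ℝ) / (2 * x) ≤ r n, r n ≤ Q.card / 2 := by
    calc _ ≤ ∑ n ∈ I with ¬ (Q.card : ℝ) / (2 * x) ≤ r n, (Q.card : ℝ) / (2 * x) :=
          Finset.sum_le_sum fun n hn ↦ (not_le.1 (Finset.mem_filter.1 hn).2).le
      _ ≤ x * ((Q.card : ℝ) / (2 * x)) := by
          rw [Finset.sum_const, nsmul_eq_mul]
          gcongr
          exact (Nat.cast_le.2 (Finset.card_filter_le _ _)).trans hI
      _ = _ := by field_simp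
  have hbig : (Q.card : ℝ) / 2 ≤ ∑ n ∈ J, r n := by
    have := Finset.sum_filter_add_sum_filter_not I (fun n ↦ (Q.card : ℝ) / (2 * x) ≤ r n) r
    rw [hsum] at this
    linarith
  have hJE : ∑ n ∈ J, r n ^ 2 ≤ (((Q ×ˢ Q).filter fun w ↦ g w.1 = g w.2).card : ℝ) := by
    rw [← hE]
    exact Finset.sum_le_sum_of_subset_of_nonneg (Finset.filter_subset _ _)
      fun _ _ _ ↦ by positivity
  have hCS := sq_sum_le_card_mul_sum_sq (s := J) (f := r)
  have h1 : ((Q.card : ℝ) / 2) ^ 2 ≤ (∑ n ∈ J, r n) ^ 2 := by gcongr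
  have h2 : (J.card : ℝ) * ∑ n ∈ J, r n ^ 2 ≤
      J.card * (((Q ×ˢ Q).filter fun w ↦ g w.1 = g w.2).card : ℝ) := by gcongr
  nlinarith

/-- The indices `k` with `A k ≤ y`. -/
noncomputable def indexSet (A : ℕ → ℕ) (y : ℝ) : Finset ℕ :=
  (Finset.range (⌊y⌋₊ + 1)).filter fun k ↦ (A k : ℝ) ≤ y

/-- Strict monotonicity gives k ≤ A k, so the range ⌊y⌋ + 1 misses no index. -/
theorem mem_indexSet {A : ℕ → ℕ} (hA : StrictMono A) {y : ℝ} {k : ℕ} :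
    k ∈ indexSet A y ↔ (A k : ℝ) ≤ y := by
  rw [indexSet, Finset.mem_filter, Finset.mem_range, and_iff_right_iff_imp]
  intro h
  have h1 : A k ≤ ⌊y⌋₊ := Nat.le_floor h
  have := hA.le_apply (x := k)
  omega

theorem countUpTo_eq_card {A : ℕ → ℕ} (hA : StrictMono A) (y : ℝ) :
    countUpTo A y = (indexSet A y).card := by
  rw [countUpTo, ← Set.ncard_coe_finset]
  congr 1
  ext k
  simp [mem_indexSet hA]

/-- The second index determines the first, since A w.1 = A w.2 + (t − s). -/
theorem card_add_eq_add_le_countShift {A : ℕ → ℕ} (hA : StrictMono A) {x y : ℝ} (hyx : y ≤ x)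
    {s t : ℕ} (hst : s < t) :
    ((indexSet A y ×ˢ indexSet A y).filter fun w ↦ A w.1 + s = A w.2 + t).card ≤
      countShift A x (t - s) := by
  have hfin : {n : ℕ | (A n : ℝ) ≤ x ∧ A n + (t - s) ∈ Set.range A}.Finite :=
    (indexSet A x).finite_toSet.subset fun n hn ↦ (mem_indexSet hA).2 hn.1
  rw [countShift, ← Set.ncard_coe_finset]
  refine Set.ncard_le_ncard_of_injOn Prod.snd (fun w hw ↦ ?_) (fun w hw w' hw' h ↦ ?_) hfin
  · simp only [Finset.coe_filter, Finset.mem_product, mem_indexSet hA, Set.mem_ofPred_eq] at hw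
    exact ⟨hw.1.2.trans hyx, w.1, by omega⟩
  · simp only [Finset.coe_filter, Finset.mem_product, Set.mem_ofPred_eq] at hw hw'
    refine Prod.ext (hA.injective ?_) h
    have := hw.2
    have := hw'.2
    rw [h] at *
    omega

theorem card_add_eq_add_le_of_eq {A : ℕ → ℕ} (hA : StrictMono A) {y : ℝ} (s : ℕ) :
    ((indexSet A y ×ˢ indexSet A y).filter fun w ↦ A w.1 + s = A w.2 + s).card ≤
      (indexSet A y).card := by
  refine Finset.card_le_card_of_injOn Prod.fst (fun w hw ↦ ?_) (fun w hw w' hw' h ↦ ?_)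
  · exact (Finset.mem_product.1 (Finset.mem_filter.1 hw).1).1
  · have h1 := (Finset.mem_filter.1 hw).2
    have h2 := (Finset.mem_filter.1 hw').2
    refine Prod.ext h (hA.injective ?_)
    rw [h] at h1
    omega

/-- The number of coincidences `A k + T p = A k' + T p'`, in terms of the shifted counts. -/
theorem card_energy_le {A : ℕ → ℕ} (hA : StrictMono A) {x y : ℝ} (hyx : y ≤ x) (P : Finset ℕ)
    (T : ℕ → ℕ) (m : ℕ) (hm : ∀ q ∈ P, (P.filter fun p ↦ T p = T q).card ≤ m) :
    ((((indexSet A y ×ˢ P) ×ˢ (indexSet A y ×ˢ P)).filter fun w ↦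
        A w.1.1 + T w.1.2 = A w.2.1 + T w.2.2).card : ℝ) ≤
      m * (indexSet A y).card * P.card +
        2 * ∑ q ∈ P, ∑ p ∈ P.filter fun p ↦ T q < T p, (countShift A x (T p - T q) : ℝ) := by
  set K := indexSet A y with hK
  set c : ℕ → ℕ → ℕ := fun q p ↦
    ((K ×ˢ K).filter fun w ↦ A w.1 + T q = A w.2 + T p).card with hc
  set σ : ℕ → ℕ → ℝ := fun q p ↦ if T q < T p then (countShift A x (T p - T q) : ℝ) else 0 with hσ
  have h1 : ((((K ×ˢ P) ×ˢ (K ×ˢ P)).filter fun w ↦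
      A w.1.1 + T w.1.2 = A w.2.1 + T w.2.2).card : ℝ) = ∑ q ∈ P, ∑ p ∈ P, (c q p : ℝ) := by
    rw [← Finset.sum_product', Finset.card_eq_sum_card_fiberwise
      (f := fun w : (ℕ × ℕ) × (ℕ × ℕ) ↦ (w.1.2, w.2.2)) (t := P ×ˢ P) fun w hw ↦ by
        have := (Finset.mem_filter.1 hw).1
        simp only [Finset.mem_product] at this
        exact Finset.mem_product.2 ⟨this.1.2, this.2.2⟩]
    push_cast
    refine Finset.sum_congr rfl fun z hz ↦ ?_
    obtain ⟨hz1, hz2⟩ := Finset.mem_product.1 hz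
    congr 1
    refine Finset.card_bij' (fun w _ ↦ (w.1.1, w.2.1)) (fun v _ ↦ ((v.1, z.1), (v.2, z.2)))
      ?_ ?_ ?_ ?_
    · rintro ⟨⟨k, p⟩, k', p'⟩ hw
      simp only [Finset.mem_filter, Finset.mem_product] at hw ⊢
      obtain ⟨⟨⟨⟨h1, h2⟩, h3, h4⟩, h5⟩, rfl⟩ := hw
      exact ⟨⟨h1, h3⟩, h5⟩
    · rintro ⟨k, k'⟩ hw
      simp only [Finset.mem_filter, Finset.mem_product] at hw ⊢
      exact ⟨⟨⟨⟨hw.1.1, hz1⟩, hw.1.2, hz2⟩, hw.2⟩, trivial⟩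
    · rintro ⟨⟨k, p⟩, k', p'⟩ hw
      simp only [Finset.mem_filter, Finset.mem_product] at hw ⊢
      obtain ⟨-, rfl⟩ := hw
      rfl
    · rintro ⟨k, k'⟩ _
      rfl
  -- At most one of `σ q p` and `σ p q` is nonzero, according to the sign of T p − T q; symmetry
  -- later gives the factor 2.
  have h2 : ∀ q p, (c q p : ℝ) ≤ (if T p = T q then (K.card : ℝ) else 0) + (σ q p + σ p q) := by
    intro q p
    simp only [hσ]
    rcases lt_trichotomy (T q) (T p) with h | h | h
    · rw [if_neg h.ne', if_pos h, if_neg h.not_gt, zero_add, add_zero]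
      exact_mod_cast card_add_eq_add_le_countShift hA hyx h
    · rw [if_pos h.symm, if_neg h.not_lt, if_neg h.not_gt, add_zero, add_zero]
      simp only [hc, h]
      exact_mod_cast card_add_eq_add_le_of_eq hA (y := y) (T p)
    · rw [if_neg h.ne, if_neg h.not_gt, if_pos h, zero_add, zero_add]
      have h3 := card_add_eq_add_le_countShift (A := A) hA hyx h
      have h4 : c q p = c p q := by
        refine Finset.card_bij' (fun w _ ↦ w.swap) (fun w _ ↦ w.swap) ?_ ?_ ?_ ?_
        · rintro ⟨k, k'⟩ hw
          simp only [Finset.mem_filter, Finset.mem_product, Prod.swap] at hw ⊢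
          exact ⟨hw.1.symm, hw.2.symm⟩
        · rintro ⟨k, k'⟩ hw
          simp only [Finset.mem_filter, Finset.mem_product, Prod.swap] at hw ⊢
          exact ⟨hw.1.symm, hw.2.symm⟩
        · intros; rfl
        · intros; rfl
      rw [h4]
      exact_mod_cast h3
  have h3 : ∑ q ∈ P, ∑ p ∈ P, σ p q = ∑ q ∈ P, ∑ p ∈ P, σ q p := Finset.sum_comm
  have h4 : ∑ q ∈ P, ∑ p ∈ P, σ q p
      = ∑ q ∈ P, ∑ p ∈ P.filter fun p ↦ T q < T p, (countShift A x (T p - T q) : ℝ) :=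
    Finset.sum_congr rfl fun q _ ↦ (Finset.sum_filter _ _).symm
  have h5 : ∑ q ∈ P, ∑ p ∈ P, (if T p = T q then (K.card : ℝ) else 0) ≤ m * K.card * P.card := by
    calc _ ≤ ∑ q ∈ P, (m : ℝ) * K.card := by
          refine Finset.sum_le_sum fun q hq ↦ ?_
          rw [← Finset.sum_filter, Finset.sum_const, nsmul_eq_mul]
          gcongr
          exact hm q hq
      _ = _ := by rw [Finset.sum_const, nsmul_eq_mul]; ring
  rw [h1]
  calc _ ≤ ∑ q ∈ P, ∑ p ∈ P, ((if T p = T q then (K.card : ℝ) else 0) + (σ q p + σ p q)) :=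
        Finset.sum_le_sum fun q _ ↦ Finset.sum_le_sum fun p _ ↦ h2 q p
    _ = ∑ q ∈ P, ∑ p ∈ P, (if T p = T q then (K.card : ℝ) else 0)
          + 2 * ∑ q ∈ P, ∑ p ∈ P, σ q p := by
        simp only [Finset.sum_add_distrib]
        rw [h3]
        ring
    _ ≤ _ := by rw [h4]; linarith

/-! ### From coincidences to popular sums -/

/-- The difference factors as a^u (a^{v−u} − 1) with coprime factors, and a^u has the same prime
factors as a. -/
theorem pow_sub_pow_div_totient {a u v : ℕ} (ha : 2 ≤ a) (hu : 1 ≤ u) (huv : u < v) :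
    ((a ^ v - a ^ u : ℕ) : ℝ) / Nat.totient (a ^ v - a ^ u) =
      (a : ℝ) / Nat.totient a *
        (((a ^ (v - u) - 1 : ℕ) : ℝ) / Nat.totient (a ^ (v - u) - 1)) := by
  obtain ⟨w, rfl⟩ := Nat.exists_eq_add_of_lt huv
  have h1 : u + w + 1 - u = w + 1 := by omega
  have h2 : a ^ (u + w + 1) - a ^ u = a ^ u * (a ^ (w + 1) - 1) := by
    rw [Nat.mul_sub, ← pow_add, mul_one, add_assoc]
  have hcop : (a ^ u).Coprime (a ^ (w + 1) - 1) := by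
    refine Nat.Coprime.pow_left _ ?_
    have h3 : 1 ≤ a ^ (w + 1) := Nat.one_le_pow _ _ (by omega)
    have h4 : (a ^ (w + 1)).Coprime (a ^ (w + 1) - 1) := by
      have := (Nat.coprime_self_sub_right h3).2 (Nat.coprime_one_right (a ^ (w + 1)))
      exact this
    exact Nat.Coprime.coprime_dvd_left (dvd_pow_self a (by omega)) h4
  rw [h1, h2, Nat.totient_mul hcop, Nat.cast_mul, Nat.cast_mul, mul_div_mul_comm]
  congr 1
  rw [div_totient_eq_prod _ (pow_pos (by omega) u).ne', div_totient_eq_prod a (by omega),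
    Nat.primeFactors_pow _ (by omega)]

-- `Set.ncard` of an infinite set is 0, so `reprCount` can be bounded below only once finiteness is
-- known.
open Polynomial in
theorem finite_setOf_add_pow_eq {A : ℕ → ℕ} (hA : StrictMono A) {a : ℕ} (ha : 2 ≤ a) (f : ℤ[X])
    (hd : 1 ≤ f.natDegree) (hpos : ∀ n : ℕ, 1 ≤ n → 0 < f.eval (n : ℤ)) (n : ℕ) :
    {q : ℕ × ℕ | q.2.Prime ∧ A q.1 + a ^ (f.eval (q.2 : ℤ)).toNat = n}.Finite := by
  have h1 : ∀ c : ℤ, {p : ℕ | f.eval (p : ℤ) = c}.Finite := fun c ↦ by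
    by_contra hinf
    obtain ⟨s, hs, hcard⟩ := Set.Infinite.exists_subset_card_eq hinf (f.natDegree + 1)
    have := card_le_natDegree_of_eval_eq f hd c s fun n hn ↦ hs hn
    omega
  refine ((Set.finite_Iic n).prod
    ((Set.finite_Icc (0 : ℤ) n).biUnion fun c _ ↦ h1 c)).subset fun q hq ↦ ?_
  obtain ⟨hp, hq⟩ := hq
  have h2 := hA.le_apply (x := q.1)
  have h3 : (f.eval (q.2 : ℤ)).toNat < a ^ (f.eval (q.2 : ℤ)).toNat := Nat.lt_pow_self (by omega)
  have h4 := hpos q.2 hp.one_le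
  refine Set.mem_prod.2 ⟨Set.mem_Iic.2 (by omega), Set.mem_iUnion₂.2
    ⟨f.eval (q.2 : ℤ), Set.mem_Icc.2 ⟨h4.le, by omega⟩, rfl⟩⟩

open Polynomial in
theorem card_filter_le_reprCount {A : ℕ → ℕ} (hA : StrictMono A) {a : ℕ} (ha : 2 ≤ a) (f : ℤ[X])
    (hd : 1 ≤ f.natDegree) (hpos : ∀ n : ℕ, 1 ≤ n → 0 < f.eval (n : ℤ)) (K P : Finset ℕ)
    (hP : ∀ p ∈ P, p.Prime) (n : ℕ) :
    ((K ×ˢ P).filter fun u ↦ A u.1 + a ^ (f.eval (u.2 : ℤ)).toNat = n).card ≤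
      reprCount A a f n := by
  rw [reprCount, ← Set.ncard_coe_finset]
  refine Set.ncard_le_ncard (fun u hu ↦ ?_) (finite_setOf_add_pow_eq hA ha f hd hpos n)
  obtain ⟨h1, h2⟩ := Finset.mem_filter.1 hu
  exact ⟨hP _ (Finset.mem_product.1 h1).2, h2⟩

set_option maxHeartbeats 1000000 in
open Polynomial in
/-- The number of popular sums `A k + a ^ f(p)` with `p ∈ (√Y, Y]`, in terms of the number of
these primes. -/
theorem exists_mul_card_largePrimes_le (a : ℕ) (ha : 2 ≤ a) (f : ℤ[X])
    (hd : 1 ≤ f.natDegree) (hlead : 0 < f.leadingCoeff)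
    (hpos : ∀ n : ℕ, 1 ≤ n → 0 < f.eval (n : ℤ)) (B : ℝ) (hB : 1 ≤ B)
    (hfB : ∀ n : ℕ, 1 ≤ n → ((f.eval (n : ℤ) : ℤ) : ℝ) ≤ B * (n : ℝ) ^ f.natDegree)
    (K₁ K₂ K₃ K₄ : ℝ) (hK₁ : 0 < K₁) (hK₂ : 0 < K₂) (hK₃ : 0 < K₃) (hK₄ : 0 < K₄) :
    ∃ C : ℝ, 0 < C ∧ ∀ (A : ℕ → ℕ) (η : ℝ → ℝ) (X : ℝ), SieveRegular A η X K₁ K₂ K₃ K₄ →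
      ∀ x : ℝ, 0 < x → X ≤ x → ∀ Y : ℕ, 2 ≤ Y →
        1 / 4 * (Y / Real.log Y) ≤ ((largePrimes Y).card : ℝ) →
        (∀ p ∈ largePrimes Y, ((a ^ (f.eval (p : ℤ)).toNat : ℕ) : ℝ) ≤ x / 2) →
        x * (largePrimes Y).card ≤ C * (η x + (largePrimes Y).card) *
          (({n : ℕ | 1 ≤ n ∧ (n : ℝ) ≤ x ∧
            (largePrimes Y).card / (2 * K₂ * K₃ * η x) ≤ (reprCount A a f n : ℝ)}.ncard : ℕ) :
              ℝ) := by
  obtain ⟨C, hC, hsum⟩ := exists_sum_pow_sub_one_div_totient_le a ha f hd hlead B hB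
  set ha' : ℝ := (a : ℝ) / Nat.totient a with hha
  have hha0 : 0 < ha' := div_pos (by exact_mod_cast (show 0 < a by omega))
    (by exact_mod_cast Nat.totient_pos.2 (show 0 < a by omega))
  -- Diagonal plus off-diagonal contribution; 8 is the 2 from symmetry times the 4 in Y / log Y ≤
  -- 4N.
  set C₆ : ℝ := f.natDegree * K₁ + 8 * K₄ * ha' * C with hC₆
  have hC₆0 : 0 < C₆ := by positivity
  refine ⟨4 * (K₂ * K₃) ^ 2 * C₆, by positivity, fun A η X hreg x hx hXx Y hY hNM hT ↦ ?_⟩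
  have hA := hreg.strictMono
  have hη := hreg.eta_pos x hXx
  set P := largePrimes Y with hP
  have hPprime : ∀ p ∈ P, p.Prime := fun p hp ↦ (mem_largePrimes.1 hp).2.1
  set F : ℕ → ℕ := fun p ↦ (f.eval (p : ℤ)).toNat with hF
  set T : ℕ → ℕ := fun p ↦ a ^ F p with hTdef
  set N : ℝ := (P.card : ℝ) with hN
  set M : ℝ := (Y : ℝ) / Real.log Y with hM
  have hM0 : 0 < M := by
    have : (2 : ℝ) ≤ Y := by exact_mod_cast hY
    exact div_pos (by linarith) (Real.log_pos (by linarith))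
  have hN0 : 0 < N := by linarith
  have hFpos : ∀ p ∈ P, 0 < f.eval (p : ℤ) := fun p hp ↦ hpos p (hPprime p hp).one_le
  obtain ⟨-, hsumq⟩ := hsum Y hY fun p hp ↦ ⟨hFpos p hp,
    (hfB p (hPprime p hp).one_le).trans (by
      have : (p : ℝ) ≤ Y := by exact_mod_cast (mem_largePrimes.1 hp).1
      gcongr)⟩
  have hTlt : ∀ q ∈ P, ∀ p ∈ P, T q < T p ↔ f.eval (q : ℤ) < f.eval (p : ℤ) := by
    intro q hq p hp
    have h1 := hFpos q hq
    have h2 := hFpos p hp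
    rw [hTdef]
    simp only
    rw [Nat.pow_lt_pow_iff_right (by omega)]
    simp only [hF]
    omega
  set K := indexSet A (x / 2) with hK
  set k : ℝ := (K.card : ℝ) with hk
  have hkK : k = countUpTo A (x / 2) := by rw [hk, countUpTo_eq_card hA]
  have hcount := hreg.count_le x hXx
  have hcount' := hreg.le_count x hXx
  have hhalf := hreg.count_half x hXx
  rw [← hkK] at hhalf
  have hkle : k ≤ K₁ * (x / η x) := by
    refine le_trans ?_ hcount
    rw [countUpTo_eq_card hA, hk]
    refine Nat.cast_le.2 (Finset.card_le_card fun i hi ↦ ?_)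
    rw [hK, mem_indexSet hA] at hi
    rw [mem_indexSet hA]
    linarith
  have hkge : x / η x ≤ K₂ * K₃ * k := by
    calc x / η x ≤ K₂ * (countUpTo A x : ℝ) := hcount'
      _ ≤ K₂ * (K₃ * k) := by gcongr
      _ = _ := by ring
  set W : ℝ := x / η x with hW
  have hW0 : 0 < W := by positivity
  have hk0 : 0 < k := by
    by_contra! h
    have : K₂ * K₃ * k ≤ 0 := mul_nonpos_of_nonneg_of_nonpos (by positivity) h
    linarith
  have hmult : ∀ q ∈ P, (P.filter fun p ↦ T p = T q).card ≤ f.natDegree := fun q hq ↦ by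
    refine card_le_natDegree_of_eval_eq f hd (f.eval (q : ℤ)) _ fun p hp ↦ ?_
    obtain ⟨hp1, hp2⟩ := Finset.mem_filter.1 hp
    have h1 := hTlt q hq p hp1
    have h2 := hTlt p hp1 q hq
    omega
  have hE := card_energy_le hA (show x / 2 ≤ x by linarith) P T f.natDegree hmult
  set E : ℝ := ((((K ×ˢ P) ×ˢ (K ×ˢ P)).filter fun w ↦
        A w.1.1 + T w.1.2 = A w.2.1 + T w.2.2).card : ℝ) with hEdef
  have hshift : ∑ q ∈ P, ∑ p ∈ P.filter fun p ↦ T q < T p, (countShift A x (T p - T q) : ℝ) ≤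
      N * (K₄ * ha' * (x / η x ^ 2) * (C * M)) := by
    rw [hN, ← nsmul_eq_mul]
    refine Finset.sum_le_card_nsmul _ _ _ fun q hq ↦ ?_
    have hfilter : (P.filter fun p ↦ T q < T p)
        = P.filter fun p : ℕ ↦ f.eval (q : ℤ) < f.eval (p : ℤ) :=
      Finset.filter_congr fun p hp ↦ hTlt q hq p hp
    rw [hfilter]
    refine le_trans (Finset.sum_le_sum fun p hp ↦ ?_)
      ((Finset.mul_sum _ _ _).symm.le.trans (mul_le_mul_of_nonneg_left (hsumq q hq)
        (show 0 ≤ K₄ * ha' * (x / η x ^ 2) by positivity)))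
    obtain ⟨hp1, hp2⟩ := Finset.mem_filter.1 hp
    have hlt := (hTlt q hq p hp1).2 hp2
    refine (hreg.count_shift x hXx (T p - T q) (by omega)).trans (le_of_eq ?_)
    have h1 := hFpos q hq
    have h2 := pow_sub_pow_div_totient ha (u := F q) (v := F p) (by simp only [hF]; omega)
      (by simp only [hF]; omega)
    simp only [hTdef]
    rw [h2]
    ring
  have hEle : E * η x ≤ C₆ * W * N * (η x + N) := by
    have h1 : E ≤ f.natDegree * (K₁ * W) * N + 2 * (N * (K₄ * ha' * (x / η x ^ 2) *
        (C * (4 * N)))) := by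
      refine hE.trans (add_le_add (by gcongr) ?_)
      refine mul_le_mul_of_nonneg_left (hshift.trans ?_) (by norm_num)
      gcongr
      linarith
    have h2 : (f.natDegree * (K₁ * W) * N + 2 * (N * (K₄ * ha' * (x / η x ^ 2) *
        (C * (4 * N))))) * η x =
        f.natDegree * K₁ * W * N * η x + 8 * K₄ * ha' * C * W * N * N := by
      rw [hW]
      field_simp
      ring
    calc E * η x ≤ _ := mul_le_mul_of_nonneg_right h1 hη.le
      _ = _ := h2
      _ ≤ C₆ * W * N * η x + C₆ * W * N * N := by
          have h3 : (f.natDegree : ℝ) * K₁ ≤ C₆ := by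
            have : 0 < 8 * K₄ * ha' * C := by positivity
            linarith
          have h4 : 8 * K₄ * ha' * C ≤ C₆ := by
            have : 0 ≤ (f.natDegree : ℝ) * K₁ := by positivity
            linarith
          gcongr
      _ = _ := by ring
  have hpop := sq_card_le_mul_card_popular (K ×ˢ P) (fun u ↦ A u.1 + T u.2)
    (Finset.Icc 1 ⌊x⌋₊) (fun u hu ↦ by
      obtain ⟨hu1, hu2⟩ := Finset.mem_product.1 hu
      rw [hK, mem_indexSet hA] at hu1
      refine Finset.mem_Icc.2 ⟨le_add_right (hreg.pos _), Nat.le_floor ?_⟩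
      have := hT u.2 hu2
      simp only [hTdef, hF]
      push_cast at this ⊢
      linarith) x hx (by simpa using Nat.floor_le hx.le)
  set J := (Finset.Icc 1 ⌊x⌋₊).filter fun n ↦ ((K ×ˢ P).card : ℝ) / (2 * x) ≤
    (((K ×ˢ P).filter fun u ↦ A u.1 + T u.2 = n).card : ℝ) with hJ
  have hJle : (J.card : ℝ) ≤ (({n : ℕ | 1 ≤ n ∧ (n : ℝ) ≤ x ∧
      N / (2 * K₂ * K₃ * η x) ≤ (reprCount A a f n : ℝ)}.ncard : ℕ) : ℝ) := by
    rw [← Set.ncard_coe_finset]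
    refine Nat.cast_le.2 (Set.ncard_le_ncard (fun n hn ↦ ?_)
      ((Set.finite_Iic ⌊x⌋₊).subset fun n hn ↦ Set.mem_Iic.2 (Nat.le_floor hn.2.1)))
    obtain ⟨hn1, hn2⟩ := Finset.mem_filter.1 hn
    rw [Finset.mem_Icc] at hn1
    refine ⟨hn1.1, (Nat.le_floor_iff hx.le).1 hn1.2, ?_⟩
    refine le_trans ?_ (hn2.trans (Nat.cast_le.2
      (card_filter_le_reprCount hA ha f hd hpos K P hPprime n)))
    rw [Finset.card_product, Nat.cast_mul, ← hk, ← hN, div_le_div_iff₀ (by positivity)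
      (by positivity)]
    have h1 : x ≤ K₂ * K₃ * k * η x := by rwa [hW, div_le_iff₀ hη] at hkge
    nlinarith
  refine le_trans ?_ (mul_le_mul_of_nonneg_left hJle (by positivity))
  rw [Finset.card_product, Nat.cast_mul, ← hk, ← hN, ← hEdef] at hpop
  have h1 : W ^ 2 ≤ (K₂ * K₃ * k) ^ 2 := by gcongr
  have hJ0 : (0 : ℝ) ≤ J.card := by positivity
  -- Combines k ≥ W/(K₂K₃), the second moment inequality and the bound for E; one factor W N then
  -- cancels.
  have h2 : (W * N) * (W * N * η x) ≤
      (W * N) * (4 * (K₂ * K₃) ^ 2 * C₆ * (η x + N) * J.card) := by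
    calc (W * N) * (W * N * η x) = W ^ 2 * (N ^ 2 * η x) := by ring
      _ ≤ (K₂ * K₃ * k) ^ 2 * (N ^ 2 * η x) := by gcongr
      _ = (K₂ * K₃) ^ 2 * η x * (k * N) ^ 2 := by ring
      _ ≤ (K₂ * K₃) ^ 2 * η x * (4 * E * J.card) := by gcongr
      _ = (K₂ * K₃) ^ 2 * 4 * J.card * (E * η x) := by ring
      _ ≤ (K₂ * K₃) ^ 2 * 4 * J.card * (C₆ * W * N * (η x + N)) := by gcongr
      _ = _ := by ring
  have h3 := le_of_mul_le_mul_left h2 (by positivity)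
  have h4 : W * N * η x = x * N := by
    rw [hW, mul_right_comm, div_mul_cancel₀ _ hη.ne']
  linarith

/-! ### The choice of Y and the conclusion -/

theorem theoremT (a : ℕ) (ha : 2 ≤ a) (f : Polynomial ℤ) (d : ℕ) (hd : 1 ≤ d)
    (hdeg : f.natDegree = d) (hlead : 0 < f.leadingCoeff) (hprim : f.IsPrimitive)
    (hpos : ∀ n : ℕ, 1 ≤ n → 0 < f.eval (n : ℤ))
    (K₁ K₂ K₃ K₄ : ℝ) (hK₁ : 0 < K₁) (hK₂ : 0 < K₂) (hK₃ : 0 < K₃) (hK₄ : 0 < K₄) :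
    ∃ x₀ c₁ c₂ : ℝ, 0 < x₀ ∧ 0 < c₁ ∧ 0 < c₂ ∧
      ∀ (A : ℕ → ℕ) (η : ℝ → ℝ) (X : ℝ), SieveRegular A η X K₁ K₂ K₃ K₄ →
        ∀ x : ℝ, x₀ ≤ x → X ≤ x →
          c₂ * (x * (Real.log x ^ (1 / (d : ℝ)) /
              (Real.log x ^ (1 / (d : ℝ)) + η x * Real.log (Real.log x)))) ≤
            (({n : ℕ | 1 ≤ n ∧ (n : ℝ) ≤ x ∧
              c₁ * (Real.log x ^ (1 / (d : ℝ)) / (η x * Real.log (Real.log x))) ≤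
                (reprCount A a f n : ℝ)}.ncard : ℕ) : ℝ) := by
  subst hdeg
  obtain ⟨B, hB, hfB⟩ := exists_eval_le_mul_pow f
  obtain ⟨C, hC, hmain⟩ := exists_mul_card_largePrimes_le a ha f hd hlead hpos B hB hfB
    K₁ K₂ K₃ K₄ hK₁ hK₂ hK₃ hK₄
  obtain ⟨Y₀, hY₀2, hY₀⟩ := exists_le_card_largePrimes
  set d := f.natDegree with hddef
  have hdr : (1 : ℝ) ≤ d := by exact_mod_cast hd
  set la := Real.log a with hla
  have hla2 : Real.log 2 ≤ la := Real.log_le_log (by norm_num) (by exact_mod_cast ha)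
  have hlog2 := Real.log_two_gt_d9
  -- Y ≈ β (log x)^{1/d} gives B Y^d log a ≤ (log x)/2, which keeps a^{f(p)} below √x ≤ x/2.
  set D : ℝ := 2 * B * la with hD
  have hD1 : 1 ≤ D := by nlinarith
  set β : ℝ := (1 / D) ^ (1 / (d : ℝ)) with hβ
  have hβ0 : 0 < β := by positivity
  -- β/8 is the 1/4 of the prime count times the loss β/2 from the floor; the cap 1 is needed when
  -- comparing w/(w + η) with N/(N + η).
  set c₃ : ℝ := min 1 (β / 8) with hc₃
  have hc₃0 : 0 < c₃ := by positivity
  obtain ⟨x₁, hx₁⟩ := (((tendsto_rpow_atTop (show (0 : ℝ) < 1 / (d : ℝ) by positivity)).comp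
    Real.tendsto_log_atTop).eventually_ge_atTop ((Y₀ + 2) / β)).exists_forall_of_atTop
  refine ⟨max 16 x₁, c₃ / (2 * K₂ * K₃), c₃ / C, by positivity, by positivity, by positivity,
    fun A η X hreg x hx hXx ↦ ?_⟩
  have hx16 : 16 ≤ x := (le_max_left _ _).trans hx
  have hx0 : 0 < x := by linarith
  have hη := hreg.eta_pos x hXx
  set ℓ := Real.log x with hℓ
  set L := ℓ ^ (1 / (d : ℝ)) with hL
  have hℓ4 : 4 * Real.log 2 ≤ ℓ := by
    have := Real.log_le_log (by norm_num) hx16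
    rwa [show (16 : ℝ) = 2 ^ 4 by norm_num, Real.log_pow] at this
  have hℓ1 : 1 < ℓ := by linarith
  have hL0 : 0 < L := by positivity
  have hLL : 0 < Real.log ℓ := Real.log_pos hℓ1
  have hβL : (Y₀ : ℝ) + 2 ≤ β * L := by
    have := hx₁ x ((le_max_right _ _).trans hx)
    rw [Function.comp_apply, div_le_iff₀ hβ0] at this
    linarith
  set Y := ⌊β * L⌋₊ with hY
  have hYle : (Y : ℝ) ≤ β * L := Nat.floor_le (by positivity)
  have hYY₀ : Y₀ ≤ Y := Nat.le_floor (by linarith)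
  have hYge : β * L / 2 ≤ Y := by
    have := Nat.lt_floor_add_one (β * L)
    rw [← hY] at this
    have : (0 : ℝ) ≤ Y₀ := by positivity
    linarith
  have hY2 : 2 ≤ Y := hY₀2.trans hYY₀
  have hY2r : (2 : ℝ) ≤ Y := by exact_mod_cast hY2
  have hlogY : 0 < Real.log Y := Real.log_pos (by linarith)
  have hYd : (Y : ℝ) ^ d ≤ ℓ / D := by
    calc (Y : ℝ) ^ d ≤ (β * L) ^ d := by gcongr
      _ = ℓ / D := by
        rw [hβ, hL, ← Real.mul_rpow (by positivity) (by positivity), ← Real.rpow_natCast,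
          ← Real.rpow_mul (by positivity), one_div_mul_cancel (by positivity), Real.rpow_one]
        ring
  have hYℓ : (Y : ℝ) ≤ ℓ := by
    calc (Y : ℝ) ≤ (Y : ℝ) ^ d := le_self_pow₀ (by linarith) (by omega)
      _ ≤ ℓ / D := hYd
      _ ≤ ℓ := div_le_self (by linarith) hD1
  have hlogYle : Real.log Y ≤ Real.log ℓ := Real.log_le_log (by linarith) hYℓ
  have hcard := hY₀ Y hYY₀
  have hT : ∀ p ∈ largePrimes Y, ((a ^ (f.eval (p : ℤ)).toNat : ℕ) : ℝ) ≤ x / 2 := by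
    intro p hp
    obtain ⟨hpY, hpp, -⟩ := mem_largePrimes.1 hp
    have har : (0 : ℝ) < a := by exact_mod_cast (show 0 < a by omega)
    push_cast
    rw [← Real.log_le_log_iff (by positivity) (by positivity), Real.log_pow,
      Real.log_div hx0.ne' (by norm_num)]
    have h1 : (((f.eval (p : ℤ)).toNat : ℕ) : ℝ) = ((f.eval (p : ℤ) : ℤ) : ℝ) := by
      have := Int.toNat_of_nonneg (hpos p hpp.one_le).le
      exact_mod_cast congrArg (fun z : ℤ ↦ (z : ℝ)) this
    have h2 : ((f.eval (p : ℤ) : ℤ) : ℝ) ≤ B * (ℓ / D) := by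
      refine (hfB p hpp.one_le).trans ?_
      have h3 : (p : ℝ) ≤ Y := by exact_mod_cast hpY
      have h4 : (p : ℝ) ^ d ≤ (Y : ℝ) ^ d := by gcongr
      exact mul_le_mul_of_nonneg_left (h4.trans hYd) (by linarith)
    rw [h1]
    have h5 : B * (ℓ / D) * la = ℓ / 2 := by
      have hla0 : la ≠ 0 := by linarith
      rw [hD]
      field_simp
    have h6 : ((f.eval (p : ℤ) : ℤ) : ℝ) * la ≤ B * (ℓ / D) * la := by gcongr
    linarith
  have hfin := hmain A η X hreg x hx0 hXx Y hY2 hcard hT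
  set N : ℝ := ((largePrimes Y).card : ℝ) with hN
  set w : ℝ := L / Real.log ℓ with hw
  have hw0 : 0 < w := by positivity
  have hNw : c₃ * w ≤ N := by
    calc c₃ * w ≤ β / 8 * w := by gcongr; exact min_le_right _ _
      _ = 1 / 4 * ((β * L / 2) / Real.log ℓ) := by rw [hw]; ring
      _ ≤ 1 / 4 * (Y / Real.log Y) := by gcongr
      _ ≤ N := hcard
  have hN0 : 0 < N := lt_of_lt_of_le (by positivity) hNw
  set S := {n : ℕ | 1 ≤ n ∧ (n : ℝ) ≤ x ∧
    N / (2 * K₂ * K₃ * η x) ≤ (reprCount A a f n : ℝ)} with hS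
  have hmono : S.ncard ≤ {n : ℕ | 1 ≤ n ∧ (n : ℝ) ≤ x ∧
      c₃ / (2 * K₂ * K₃) * (L / (η x * Real.log ℓ)) ≤ (reprCount A a f n : ℝ)}.ncard := by
    refine Set.ncard_le_ncard (fun n hn ↦ ⟨hn.1, hn.2.1, le_trans ?_ hn.2.2⟩)
      ((Set.finite_Iic ⌊x⌋₊).subset fun n hn ↦ Set.mem_Iic.2 (Nat.le_floor hn.2.1))
    calc c₃ / (2 * K₂ * K₃) * (L / (η x * Real.log ℓ)) = c₃ * w / (2 * K₂ * K₃ * η x) := by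
          rw [hw]
          field_simp
      _ ≤ _ := by gcongr
  refine le_trans ?_ (Nat.cast_le.2 hmono)
  have h1 : L / (L + η x * Real.log ℓ) = w / (w + η x) := by
    rw [hw]
    field_simp
  have h2 : c₃ * (x * (w / (w + η x))) ≤ x * N / (η x + N) := by
    rw [mul_div_assoc', mul_div_assoc', div_le_div_iff₀ (by positivity) (by positivity)]
    have h3 : c₃ * w * η x ≤ N * η x := by gcongr
    have h4 : c₃ * w * N ≤ 1 * w * N := by
      gcongr
      exact min_le_left _ _
    nlinarith
  rw [h1, div_mul_eq_mul_div, div_le_iff₀ hC]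
  refine h2.trans ?_
  rw [div_le_iff₀ (by positivity)]
  linarith
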